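/- **Theorem 4.3.** Let $\mathcal D'=\mathcal D'(\mathbb R)$ be the space of complex-valued Schwartz distributions on $\mathbb R$, $D_x$ the distributional derivative, and regard $L^2=L^2(\mathbb R)$ as a subspace of $\mathcal D'$. Let $\widehat S$ be the operator $-d^2/dx^2$ in $L^2$ with domain $\mathcal D(\mathbb R\setminus\{0\})$, let $\widehat S^*$ be its adjoint, and let $\widehat H_0=-D_x^2:L^2\to\mathcal D'$. For $n\in\mathbb N_0$ let $\mathcal A^n=\mathcal C^n_p\oplus\mathcal F^n\subset\mathcal D'$. Here $\mathcal C_p^n$ is the space of functions that are $n$ times continuously differentiable off a finite set, at whose points all derivatives of order $\le n$ have finite lateral limits. $\mathcal F^n$ is the space of distributions of finite support and of order at most $n+1$, that is, distributional derivatives of order at most $n+1$ of locally integrable functions. For $F,G\in\mathcal A^n$ let $$F*G=\lim_{\varepsilon\downarrow0}F(x)\cdot G(x+\varepsilon)\quad\text{in }\mathcal D'.$$ The product $\cdot$ on the right is the extended Hörmander product of two elements of $\mathcal A^n$ with disjoint $n$-th order singular supports (the $n$-th order singular support being the complement of the largest open set on which the distribution is a $\mathcal C^n$ function): it is the distribution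 in $\mathcal A^n$ that, on each member of a finite open cover of $\mathbb R$ on each member of which one of the two factors is a $\mathcal C^n$ function, is the product of the other factor by that function. The product of $F\in\mathcal A^n$ by a $\mathcal C^n$ function $g$ is given by $\langle Fg,t\rangle=\langle F,gt\rangle$, where $F$ is extended continuously to compactly supported $\mathcal C^n$ functions. Let $\widehat\beta$ and $\widehat\beta'$ be the operators $$\widehat\beta F=\delta*F-F*\delta\quad(F\in\mathcal A^0),\qquad \widehat\beta'F=\delta'*F-F*\delta'\quad(F\in\mathcal A^1).$$ Let $\widehat B:\mathrm{Dom}(\widehat B)\subseteq\mathcal D'\to\mathcal D'$ be an arbitrary linear operator such that $\operatorname{supp}\widehat B\psi\subseteq\{0\}$ for every $\psi\in\mathrm{Dom}(\widehat B)$. Let $\widehat Z=\widehat H_0+\widehat B$ be the operator in $L^2$ with the maximal domain $$\mathcal D_{\max}(\widehat Z)=\{\psi\in L^2\cap\mathrm{Dom}(\widehat B):\ -D_x^2\psi+\widehat B\psi\in L^2\}.$$ Then $\widehat Z\subseteq\widehat S^*$, that is, $\mathcal D_{\max}(\widehat Z)\subseteq\mathrm{Dom}(\widehat S^*)$ and $\widehat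 Z\psi=\widehat S^*\psi$ for all $\psi\in\mathcal D_{\max}(\widehat Z)$. Moreover, $$\mathcal D_{\max}(\widehat Z)=\operatorname{Ker}\widehat F\,\cap\,\bigl(H^2(\mathbb R_-)\oplus H^2(\mathbb R_+)\bigr),\qquad \widehat F=-2\widehat\beta D_x-\widehat\beta'+\widehat B,$$ where $\operatorname{Ker}\widehat F$ consists of those $\psi\in\mathrm{Dom}(\widehat B)\cap\mathcal A^1$ with $D_x\psi\in\mathcal A^0$ for which $\widehat F\psi=0$, and $H^2(\mathbb R_-)\oplus H^2(\mathbb R_+)$ is regarded as a subspace of $L^2$. -/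

import Mathlib

open MeasureTheory Filter Topology TopologicalSpace
open scoped Distributions LineDeriv ContDiff

noncomputable section

namespace PointInteraction

/-! ### Distributions on open subsets of the line, and `L²` -/

/-- `𝓓'(Ω)`: complex valued Schwartz distributions on the open set `Ω ⊆ ℝ`. -/
abbrev Distr (Ω : Opens ℝ) := 𝓓'(Ω, ℂ)

/-- The Hilbert space `L²(ℝ)`. -/
abbrev L2 := Lp ℂ 2 (volume : Measure ℝ)

/-- The open set `ℝ \ {0}`. -/
def punctured : Opens ℝ := ⟨{0}ᶜ, isOpen_compl_singleton⟩

/-- The open half-line `ℝ₋`. -/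
def negHalf : Opens ℝ := ⟨Set.Iio 0, isOpen_Iio⟩

/-- The open half-line `ℝ₊`. -/
def posHalf : Opens ℝ := ⟨Set.Ioi 0, isOpen_Ioi⟩

/-- The regular distribution `t ↦ ∫ t f` on `Ω` of a function `f` that is locally integrable
on `Ω`. -/
def regDistr (Ω : Opens ℝ) (f : ℝ → ℂ) : Distr Ω :=
  TestFunction.integralAgainstBilinCLM (ContinuousLinearMap.lsmul ℝ ℝ) volume f

theorem regDistr_apply {Ω : Opens ℝ} {f : ℝ → ℂ} (hf : LocallyIntegrableOn f Ω volume)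
    (t : 𝓓(Ω, ℝ)) : regDistr Ω f t = ∫ x, (t x : ℂ) * f x := by
  have h : regDistr Ω f t = ∫ x, ContinuousLinearMap.lsmul ℝ ℝ (t x) (f x) :=
    TestFunction.integralAgainstBilinCLM_eq_integral hf
  simpa using h

/-- The distributional derivative `D_x`. -/
def derivD (Ω : Opens ℝ) : Distr Ω →ₗ[ℂ] Distr Ω where
  toFun T := ∂_{(1 : ℝ)} T
  map_add' S T := by ext t; simp
  map_smul' c T := by ext t; simp

theorem L2.locallyIntegrableOn (ψ : L2) (s : Set ℝ) : LocallyIntegrableOn ψ s volume :=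
  ((Lp.memLp ψ).locallyIntegrable (by norm_num)).locallyIntegrableOn s

/-- The inclusion of `L²(ℝ)` into `𝓓'(ℝ)`. -/
def ofL2 : L2 →ₗ[ℂ] Distr ⊤ where
  toFun ψ := regDistr ⊤ ψ
  map_add' ψ φ := by
    ext t
    have hψ := L2.locallyIntegrableOn ψ ((⊤ : Opens ℝ) : Set ℝ)
    have hφ := L2.locallyIntegrableOn φ ((⊤ : Opens ℝ) : Set ℝ)
    have h : (regDistr ⊤ ψ + regDistr ⊤ φ) t = regDistr ⊤ ψ t + regDistr ⊤ φ t := rfl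
    have iψ : Integrable (fun x => (t x : ℂ) * ψ x) := by
      simpa using TestFunction.integrable_bilin (ContinuousLinearMap.lsmul ℝ ℝ) hψ t
    have iφ : Integrable (fun x => (t x : ℂ) * φ x) := by
      simpa using TestFunction.integrable_bilin (ContinuousLinearMap.lsmul ℝ ℝ) hφ t
    rw [h, regDistr_apply (L2.locallyIntegrableOn _ _), regDistr_apply hψ, regDistr_apply hφ,
      ← integral_add iψ iφ]
    refine integral_congr_ae ?_
    filter_upwards [Lp.coeFn_add ψ φ] with x hx
    rw [hx, Pi.add_apply, mul_add]
  map_smul' c ψ := by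
    ext t
    have h : (c • regDistr ⊤ ψ) t = c * regDistr ⊤ ψ t := rfl
    rw [RingHom.id_apply, h, regDistr_apply (L2.locallyIntegrableOn _ _),
      regDistr_apply (L2.locallyIntegrableOn _ _), ← integral_const_mul]
    refine integral_congr_ae ?_
    filter_upwards [Lp.coeFn_smul c ψ] with x hx
    rw [hx, Pi.smul_apply, smul_eq_mul]
    ring

theorem ofL2_apply (ψ : L2) (t : 𝓓((⊤ : Opens ℝ), ℝ)) :
    ofL2 ψ t = ∫ x, (t x : ℂ) * ψ x :=
  regDistr_apply (L2.locallyIntegrableOn _ _) t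

theorem ofL2_injective : Function.Injective ofL2 := by
  rw [← LinearMap.ker_eq_bot, LinearMap.ker_eq_bot']
  intro ψ hψ
  rw [Lp.eq_zero_iff_ae_eq_zero]
  refine ae_eq_zero_of_integral_contDiff_smul_eq_zero
    ((Lp.memLp ψ).locallyIntegrable (by norm_num)) fun g hg hc => ?_
  let t : 𝓓((⊤ : Opens ℝ), ℝ) := ⟨g, by exact_mod_cast hg, hc, fun x _ => trivial⟩
  have h := ofL2_apply ψ t
  rw [hψ] at h
  have h0 : (0 : ℂ) = ∫ x, (g x : ℂ) * ψ x := h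
  simpa using h0.symm

/-! ### The Sobolev spaces `H²(Ω)` and `H²(ℝ₋) ⊕ H²(ℝ₊)` -/

/-- `f|_Ω ∈ H²(Ω)`: `f` and its weak derivatives of order one and two on `Ω` are in `L²(Ω)`. -/
def MemH2 (Ω : Opens ℝ) (f : ℝ → ℂ) : Prop :=
  MemLp f 2 (volume.restrict Ω) ∧
    ∃ f₁ f₂ : ℝ → ℂ, MemLp f₁ 2 (volume.restrict Ω) ∧ MemLp f₂ 2 (volume.restrict Ω) ∧
      derivD Ω (regDistr Ω f) = regDistr Ω f₁ ∧ derivD Ω (regDistr Ω f₁) = regDistr Ω f₂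

/-- `H²(ℝ₋) ⊕ H²(ℝ₊)`, regarded as a subset of `L²(ℝ) = L²(ℝ₋) ⊕ L²(ℝ₊)`. -/
def H2Sum : Set L2 := {ψ | MemH2 negHalf ψ ∧ MemH2 posHalf ψ}

/-! ### The minimal operator `S`, i.e. `-d²/dx²` on `𝓓(ℝ \ {0})` -/

theorem testFunction_memLp (t : 𝓓(punctured, ℂ)) : MemLp t 2 (volume : Measure ℝ) :=
  t.continuous.memLp_of_hasCompactSupport t.hasCompactSupport

/-- The inclusion of `𝓓(ℝ \ {0})` into `L²(ℝ)`. -/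
def testToL2 : 𝓓(punctured, ℂ) →ₗ[ℂ] L2 where
  toFun t := (testFunction_memLp t).toLp t
  map_add' _ _ := rfl
  map_smul' _ _ := rfl

theorem testToL2_injective : Function.Injective testToL2 := by
  intro s t h
  have h' : (s : ℝ → ℂ) =ᵐ[volume] t :=
    (MemLp.toLp_eq_toLp_iff (testFunction_memLp s) (testFunction_memLp t)).1 h
  exact DFunLike.coe_injective ((Continuous.ae_eq_iff_eq volume s.continuous t.continuous).1 h')

/-- The derivative of test functions in `𝓓(ℝ \ {0})`. -/
def testDeriv : 𝓓(punctured, ℂ) →ₗ[ℂ] 𝓓(punctured, ℂ) :=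
  (TestFunction.lineDerivCLM ℂ (1 : ℝ) : 𝓓(punctured, ℂ) →L[ℂ] 𝓓(punctured, ℂ))

theorem testDeriv_apply (t : 𝓓(punctured, ℂ)) (x : ℝ) : testDeriv t x = deriv t x := by
  have h : testDeriv t x = lineDeriv ℝ t x 1 := by
    simp [testDeriv, TestFunction.lineDerivCLM_apply]
  rw [h]
  simp [lineDeriv, deriv_comp_const_add]

/-- The symmetric operator `S`: `S t = -t''` with domain `𝓓(ℝ \ {0}) ⊆ L²(ℝ)`. -/
def minimalOp : L2 →ₗ.[ℂ] L2 where
  domain := LinearMap.range testToL2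
  toFun := testToL2 ∘ₗ (-(testDeriv ∘ₗ testDeriv)) ∘ₗ
    ((LinearEquiv.ofInjective testToL2 testToL2_injective).symm :
      LinearMap.range testToL2 →ₗ[ℂ] 𝓓(punctured, ℂ))

theorem minimalOp_apply (t : 𝓓(punctured, ℂ)) :
    minimalOp ⟨testToL2 t, t, rfl⟩ = testToL2 (-testDeriv (testDeriv t)) := by
  have h : (LinearEquiv.ofInjective testToL2 testToL2_injective).symm ⟨testToL2 t, t, rfl⟩ = t :=
    (LinearEquiv.symm_apply_eq _).2 rfl
  change testToL2 (-(testDeriv (testDeriv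
    ((LinearEquiv.ofInjective testToL2 testToL2_injective).symm ⟨testToL2 t, t, rfl⟩)))) = _
  rw [h]

/-! ### Boundary operators and the maximal realization of `Z = H₀ + B` -/

/-- A linear operator `B : 𝓓'(ℝ) ⊇ dom B → 𝓓'(ℝ)` is a boundary operator (with boundary `{0}`)
if `supp (B ψ) ⊆ {0}` for every `ψ` in its domain. -/
def IsBoundaryOp (B : Distr ⊤ →ₗ.[ℂ] Distr ⊤) : Prop :=
  ∀ ψ : B.domain, Distribution.dsupport (B ψ) ⊆ {0}

/-- The maximal domain of `H₀ + B`, where `H₀ = -D_x²` acts in the sense of distributions: all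
`ψ ∈ L²(ℝ) ∩ dom B` such that the distribution `-D_x² ψ + B ψ` is in `L²(ℝ)`. -/
def maxDomain (B : Distr ⊤ →ₗ.[ℂ] Distr ⊤) : Submodule ℂ L2 where
  carrier := {ψ | ∃ h : ofL2 ψ ∈ B.domain, ∃ φ : L2,
    -derivD ⊤ (derivD ⊤ (ofL2 ψ)) + B ⟨ofL2 ψ, h⟩ = ofL2 φ}
  zero_mem' := by
    refine ⟨by simp, 0, ?_⟩
    have h : (⟨ofL2 0, by simp⟩ : B.domain) = 0 := by ext1; simp
    rw [h]; simp
  add_mem' := by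
    rintro ψ₁ ψ₂ ⟨h₁, φ₁, e₁⟩ ⟨h₂, φ₂, e₂⟩
    have h : ofL2 (ψ₁ + ψ₂) ∈ B.domain := by
      rw [map_add]; exact B.domain.add_mem h₁ h₂
    have e : (⟨ofL2 (ψ₁ + ψ₂), h⟩ : B.domain) = ⟨ofL2 ψ₁, h₁⟩ + ⟨ofL2 ψ₂, h₂⟩ := by
      ext1; simp
    refine ⟨h, φ₁ + φ₂, ?_⟩
    rw [e, LinearPMap.map_add, map_add, map_add, map_add, map_add, ← e₁, ← e₂]
    abel
  smul_mem' := by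
    rintro c ψ ⟨h₁, φ, e₁⟩
    have h : ofL2 (c • ψ) ∈ B.domain := by
      rw [map_smul]; exact B.domain.smul_mem c h₁
    have e : (⟨ofL2 (c • ψ), h⟩ : B.domain) = c • ⟨ofL2 ψ, h₁⟩ := by
      ext1; simp
    refine ⟨h, c • φ, ?_⟩
    rw [e, LinearPMap.map_smul, map_smul, map_smul, map_smul, map_smul, ← e₁, smul_add, smul_neg]

theorem mem_maxDomain {B : Distr ⊤ →ₗ.[ℂ] Distr ⊤} {ψ : L2} :
    ψ ∈ maxDomain B ↔ ∃ h : ofL2 ψ ∈ B.domain, ∃ φ : L2,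
      -derivD ⊤ (derivD ⊤ (ofL2 ψ)) + B ⟨ofL2 ψ, h⟩ = ofL2 φ := Iff.rfl

theorem maxDomain_sub {B : Distr ⊤ →ₗ.[ℂ] Distr ⊤} (ψ : maxDomain B) :
    ofL2 ψ ∈ B.domain := ψ.2.choose

/-- The distribution `H₀ ψ + B ψ = -D_x² ψ + B ψ`, for `ψ` in the maximal domain. -/
def formalZ (B : Distr ⊤ →ₗ.[ℂ] Distr ⊤) : maxDomain B →ₗ[ℂ] Distr ⊤ where
  toFun ψ := -derivD ⊤ (derivD ⊤ (ofL2 ψ)) + B ⟨ofL2 ψ, maxDomain_sub ψ⟩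
  map_add' ψ₁ ψ₂ := by
    have e : (⟨ofL2 ((ψ₁ + ψ₂ : maxDomain B) : L2), maxDomain_sub _⟩ : B.domain)
        = ⟨ofL2 ψ₁, maxDomain_sub _⟩ + ⟨ofL2 ψ₂, maxDomain_sub _⟩ := by
      ext1; simp
    rw [e, LinearPMap.map_add, Submodule.coe_add, map_add, map_add, map_add]
    abel
  map_smul' c ψ := by
    have e : (⟨ofL2 ((c • ψ : maxDomain B) : L2), maxDomain_sub _⟩ : B.domain)
        = c • ⟨ofL2 ψ, maxDomain_sub _⟩ := by
      ext1; simp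
    rw [e, LinearPMap.map_smul, Submodule.coe_smul, map_smul, map_smul, map_smul,
      RingHom.id_apply, smul_add, smul_neg]

theorem formalZ_mem (B : Distr ⊤ →ₗ.[ℂ] Distr ⊤) (ψ : maxDomain B) :
    formalZ B ψ ∈ LinearMap.range ofL2 := by
  obtain ⟨h, φ, e⟩ := ψ.2
  exact ⟨φ, e.symm⟩

/-- The operator `Z = H₀ + B` in `L²(ℝ)` on its maximal domain: `Z ψ` is the element of `L²(ℝ)`
that equals `-D_x² ψ + B ψ` as a distribution. -/
def schrodinger (B : Distr ⊤ →ₗ.[ℂ] Distr ⊤) : L2 →ₗ.[ℂ] L2 where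
  domain := maxDomain B
  toFun := ((LinearEquiv.ofInjective ofL2 ofL2_injective).symm :
      LinearMap.range ofL2 →ₗ[ℂ] L2) ∘ₗ
    (formalZ B).codRestrict (LinearMap.range ofL2) (formalZ_mem B)

theorem ofL2_schrodinger (B : Distr ⊤ →ₗ.[ℂ] Distr ⊤) (ψ : maxDomain B) :
    ofL2 (schrodinger B ψ) =
      -derivD ⊤ (derivD ⊤ (ofL2 ψ)) + B ⟨ofL2 ψ, maxDomain_sub ψ⟩ :=
  congrArg Subtype.val ((LinearEquiv.ofInjective ofL2 ofL2_injective).apply_symm_apply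
    ⟨formalZ B ψ, formalZ_mem B ψ⟩)

/-! ### The spaces `𝓐ⁿ = C_pⁿ ⊕ 𝓕ⁿ` -/

/-- `f ∈ C_pⁿ`: off a finite set `I` the function `f` is `n` times continuously differentiable,
and its derivatives of order `≤ n` have finite lateral limits at the points of `I`. -/
def IsPiecewiseC (n : ℕ) (f : ℝ → ℂ) : Prop :=
  ∃ I : Finset ℝ, ContDiffOn ℝ n f (I : Set ℝ)ᶜ ∧
    ∀ x ∈ I, ∀ j ≤ n, (∃ l, Tendsto (iteratedDeriv j f) (𝓝[>] x) (𝓝 l)) ∧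
      ∃ l, Tendsto (iteratedDeriv j f) (𝓝[<] x) (𝓝 l)

/-- `ord F ≤ m`: `F` is the distributional derivative, of some order `k ≤ m`, of a regular
distribution. -/
def OrderLE (m : ℕ) (F : Distr ⊤) : Prop :=
  ∃ k ≤ m, ∃ f : ℝ → ℂ, LocallyIntegrable f ∧ F = (derivD ⊤ ^ k) (regDistr ⊤ f)

/-- `F ∈ 𝓐ⁿ = C_pⁿ ⊕ 𝓕ⁿ`, where `𝓕ⁿ` is the space of distributions of finite support and of
order at most `n + 1`. -/
def MemA (n : ℕ) (F : Distr ⊤) : Prop :=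
  ∃ (f : ℝ → ℂ) (Δ : Distr ⊤), IsPiecewiseC n f ∧ (Distribution.dsupport Δ).Finite ∧
    OrderLE (n + 1) Δ ∧ F = regDistr ⊤ f + Δ

/-! ### The product `*` of distributions in `𝓐ⁿ` -/

/-- `F|_Ω = f`, for a function `f` that is continuous on the open set `Ω`. -/
def RestrictsTo (F : Distr ⊤) (Ω : Set ℝ) (f : ℝ → ℂ) : Prop :=
  ∀ t : 𝓓((⊤ : Opens ℝ), ℝ), tsupport t ⊆ Ω → F t = ∫ x, (t x : ℂ) * f x

/-- The `n`-th order singular support of `F`: the complement of the largest open set on which `F`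
is a `Cⁿ` function. -/
def nSingSupp (n : ℕ) (F : Distr ⊤) : Set ℝ :=
  (⋃₀ {Ω | IsOpen Ω ∧ ∃ f, ContDiffOn ℝ n f Ω ∧ RestrictsTo F Ω f})ᶜ

/-- `P|_Ξ = F|_Ξ g`, for `F ∈ 𝓐ⁿ` and `g ∈ Cⁿ(Ξ)`. This means `⟨P, t⟩ = ⟨F, g t⟩` for all test
functions `t` supported in `Ξ`. Since `g t` is only a compactly supported `Cⁿ` function, the
bracket on the right is that of the (unique) continuous extension `F'` of `F` to the space of such
functions; `s₁` and `s₂` are the real and the imaginary part of `g t`. -/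
def IsMulOn (n : ℕ) (Ξ : Set ℝ) (F : Distr ⊤) (g : ℝ → ℂ) (P : Distr ⊤) : Prop :=
  ∃ F' : 𝓓'^{(n : ℕ∞)}((⊤ : Opens ℝ), ℂ),
    (∀ (t : 𝓓((⊤ : Opens ℝ), ℝ)) (s : 𝓓^{(n : ℕ∞)}((⊤ : Opens ℝ), ℝ)),
      (∀ x, s x = t x) → F' s = F t) ∧
    ∀ (t : 𝓓((⊤ : Opens ℝ), ℝ)) (s₁ s₂ : 𝓓^{(n : ℕ∞)}((⊤ : Opens ℝ), ℝ)), tsupport t ⊆ Ξ →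
      (∀ x, (s₁ x : ℂ) + s₂ x * Complex.I = g x * t x) → P t = F' s₁ + F' s₂ * Complex.I

/-- `P = F · G` is the extended Hörmander product of `F, G ∈ 𝓐ⁿ`, whose `n`-th order singular
supports are disjoint: there is a finite open cover of the line such that on each of its members
one of the two factors is a `Cⁿ` function and `P` is the product of the other factor by it. -/
def IsHormanderProd (n : ℕ) (F G P : Distr ⊤) : Prop :=
  MemA n F ∧ MemA n G ∧ Disjoint (nSingSupp n F) (nSingSupp n G) ∧ MemA n P ∧
    ∃ (d : ℕ) (Ξ : Fin d → Opens ℝ), (⋃ i, (Ξ i : Set ℝ)) = Set.univ ∧ ∀ i,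
      (∃ g, ContDiffOn ℝ n g (Ξ i) ∧ RestrictsTo G (Ξ i) g ∧ IsMulOn n (Ξ i) F g P) ∨
      (∃ f, ContDiffOn ℝ n f (Ξ i) ∧ RestrictsTo F (Ξ i) f ∧ IsMulOn n (Ξ i) G f P)

/-- `G' = G(x + ε)`, i.e. `⟨G', t⟩ = ⟨G, t(x - ε)⟩`. -/
def IsTranslate (ε : ℝ) (G G' : Distr ⊤) : Prop :=
  ∀ t t' : 𝓓((⊤ : Opens ℝ), ℝ), (∀ x, t' x = t (x - ε)) → G' t = G t'

/-- `P = F * G`, for `F, G ∈ 𝓐ⁿ`: the distribution `P` is the limit of `F(x) · G(x + ε)`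
as `ε ↓ 0`. -/
def IsStarProd (n : ℕ) (F G P : Distr ⊤) : Prop :=
  MemA n F ∧ MemA n G ∧ ∃ Q : ℝ → Distr ⊤,
    (∀ᶠ ε in 𝓝[>] (0 : ℝ), ∃ G', IsTranslate ε G G' ∧ IsHormanderProd n F G' (Q ε)) ∧
    ∀ t, Tendsto (fun ε => Q ε t) (𝓝[>] 0) (𝓝 (P t))

/-! ### The operators `β⁽ⁿ⁾` and `F = -2 β D_x - β' + B` -/

/-- The Dirac measure `δ` at the origin. -/
def dirac : Distr ⊤ := Distribution.mapCLM Complex.ofRealCLM (Distribution.delta 0)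

/-- The graph of `β⁽ⁿ⁾ : 𝓐ⁿ → 𝓓'`, `β⁽ⁿ⁾ ψ = δ⁽ⁿ⁾ * ψ - ψ * δ⁽ⁿ⁾`. -/
def IsBeta (n : ℕ) (ψ V : Distr ⊤) : Prop :=
  ∃ P Q : Distr ⊤, IsStarProd n ((derivD ⊤ ^ n) dirac) ψ P ∧
    IsStarProd n ψ ((derivD ⊤ ^ n) dirac) Q ∧ V = P - Q

/-- The graph of the operator `F = -2 β D_x - β' + B`, where `β = β⁽⁰⁾` and `β' = β⁽¹⁾`; its domain
consists of the `ψ` for which each of the three terms is defined. -/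
def IsF (B : Distr ⊤ →ₗ.[ℂ] Distr ⊤) (ψ T : Distr ⊤) : Prop :=
  ∃ (h : ψ ∈ B.domain) (V W : Distr ⊤), IsBeta 0 (derivD ⊤ ψ) V ∧ IsBeta 1 ψ W ∧
    T = -(2 : ℂ) • V - W + B ⟨ψ, h⟩

/-- `Ker F`. -/
def kerF (B : Distr ⊤ →ₗ.[ℂ] Distr ⊤) : Set (Distr ⊤) := {ψ | IsF B ψ 0}

end PointInteraction

end

/-!
Everything is reduced to one formula for the second derivative of a function with a jump.

Let `ψ ∈ L²` with `ψ'' = φ` on `ℝ \ {0}` in the sense of distributions, where `φ ∈ L²`. A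
distribution on an interval whose derivative vanishes is constant
(`exists_eq_const_of_derivD_eq_zero`), so that `ψ` is almost everywhere a twofold primitive of `φ`
on each half-line (`exists_ae_eq_jumpPrim`). Thus `ψ` and `ψ'` have one-sided limits at the origin,
and with their jumps `[ψ]` and `[ψ']` one has on the whole line
`D_x² ψ = φ + [ψ'] δ + [ψ] δ'` (`derivD_derivD_ofL2`).

On the other hand, if `F` is regular off the origin, then `δ⁽ⁿ⁾ * F` is the product of `δ⁽ⁿ⁾` by
the right limits of `F` and its derivatives, and `F * δ⁽ⁿ⁾` is its product by the left limits
(`RegularOff.isStarProd_dirac_left_iff`, `RegularOff.isStarProd_dirac_right_iff`). Hence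
`β D_x ψ = [ψ'] δ` and `β' ψ = [ψ] δ' - [ψ'] δ`, and `ψ ∈ Ker F` means that
`B ψ = 2 [ψ'] δ + [ψ] δ' - [ψ'] δ = [ψ'] δ + [ψ] δ'` (`ofL2_mem_kerF_iff`). Since the products are
given as relations, their uniqueness is part of the work: it rests on the locality of distributions
(`apply_eq_zero_of_cover`) and on the density of the smooth functions in the compactly supported
`Cⁿ` functions (`ext_of_smooth`), by which a distribution has only one continuous extension.

If `ψ` is in the maximal domain of `Z`, then `B ψ` vanishes off the origin, so that `ψ'' = -Z ψ`
there. The formula for `D_x² ψ` shows that `B ψ = [ψ'] δ + [ψ] δ'`, and `ψ ∈ H²(ℝ₋) ⊕ H²(ℝ₊)`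
because `ψ, ψ'' ∈ L²` implies `ψ' ∈ L²` on a half-line (`memH2_of_ae_eq_jumpPrim`). Conversely, if
`ψ ∈ H²(ℝ₋) ⊕ H²(ℝ₊)` and `B ψ = [ψ'] δ + [ψ] δ'`, then `-D_x² ψ + B ψ = -φ ∈ L²`. Finally
`Z ⊆ S^*` because `Z` and `S` are formally adjoint, `B ψ` being invisible for test functions on
`ℝ \ {0}`, and because `S` is densely defined.
-/

noncomputable section

namespace PointInteraction

/-! ### Test functions and derivatives of Dirac measures -/

theorem lineDeriv_testFunction_apply {Ω : Opens ℝ} (t : 𝓓(Ω, ℝ)) (x : ℝ) :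
    (∂_{(1 : ℝ)} t : 𝓓(Ω, ℝ)) x = deriv t x := by
  rw [TestFunction.lineDerivOp_eq_lineDerivCLM ℝ, TestFunction.lineDerivCLM_apply_of_le (by simp)]
  simp [lineDeriv, deriv_comp_const_add]

theorem coe_lineDeriv_testFunction {Ω : Opens ℝ} (t : 𝓓(Ω, ℝ)) :
    ⇑(∂_{(1 : ℝ)} t : 𝓓(Ω, ℝ)) = deriv t :=
  funext (lineDeriv_testFunction_apply t)

theorem derivD_apply {Ω : Opens ℝ} (T : Distr Ω) (t : 𝓓(Ω, ℝ)) :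
    derivD Ω T t = -T (∂_{(1 : ℝ)} t) := by
  change (∂_{(1 : ℝ)} T) t = _
  rw [Distribution.lineDerivOp_apply_apply, map_neg]

/-- The Dirac measure `δ_a` at the point `a`. -/
def diracAt (a : ℝ) : Distr ⊤ := Distribution.mapCLM Complex.ofRealCLM (Distribution.delta a)

theorem diracAt_apply (a : ℝ) (t : 𝓓((⊤ : Opens ℝ), ℝ)) : diracAt a t = (t a : ℂ) := rfl

theorem diracAt_zero : diracAt 0 = dirac := rfl

theorem pow_derivD_diracAt_apply (n : ℕ) (a : ℝ) (t : 𝓓((⊤ : Opens ℝ), ℝ)) :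
    (derivD ⊤ ^ n) (diracAt a) t = (-1) ^ n * ((iteratedDeriv n t a : ℝ) : ℂ) := by
  induction n generalizing t with
  | zero => simp [diracAt_apply]
  | succ n ih =>
    rw [pow_succ', Module.End.mul_apply, derivD_apply, ih, coe_lineDeriv_testFunction,
      iteratedDeriv_succ']
    ring

/-- A test function that vanishes near `a` has vanishing derivatives at `a`. -/
theorem iteratedDeriv_eq_zero_of_notMem_tsupport {F : Type*} [NormedAddCommGroup F]
    [NormedSpace ℝ F] {g : ℝ → F} {a : ℝ} (h : a ∉ tsupport g) (n : ℕ) :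
    iteratedDeriv n g a = 0 := by
  have h1 := (notMem_tsupport_iff_eventuallyEq.1 h).iteratedDeriv_eq n
  rw [h1]; simp

/-! ### Locality of distributions -/

/-- A distribution that vanishes on the members of a finite open cover of the support of `t`
vanishes at `t`, by means of a smooth partition of unity. -/
theorem apply_eq_zero_of_cover {Ω : Opens ℝ} {ι : Type*} [Finite ι] (T : Distr Ω) (U : ι → Set ℝ)
    (hU : ∀ i, IsOpen (U i)) (t : 𝓓(Ω, ℝ)) (ht : tsupport t ⊆ ⋃ i, U i)
    (h : ∀ i, Distribution.IsVanishingOn T (U i)) : T t = 0 := by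
  have := Fintype.ofFinite ι
  obtain ⟨ρ, hρ⟩ := SmoothPartitionOfUnity.exists_isSubordinate (modelWithCornersSelf ℝ ℝ)
    (isClosed_tsupport t) U hU ht
  have hs (i : ι) : ContDiff ℝ ∞ (ρ i) := (ρ i).contMDiff.contDiff
  let s (i : ι) : 𝓓(Ω, ℝ) := ⟨fun x => ρ i x * t x, (hs i).mul t.contDiff,
    t.hasCompactSupport.mul_left, (tsupport_mul_subset_right).trans t.tsupport_subset⟩
  have hsum : t = ∑ i, s i := by
    ext x
    have h1 : (∑ i, s i) x = ∑ i, ρ i x * t x := by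
      rw [FunLike.coe_sum, Finset.sum_apply]
      rfl
    rw [h1, ← Finset.sum_mul]
    by_cases hx : x ∈ tsupport t
    · have := ρ.sum_eq_one hx
      rw [finsum_eq_sum_of_fintype] at this
      rw [this, one_mul]
    · simp [image_eq_zero_of_notMem_tsupport hx]
  rw [hsum, map_sum]
  exact Finset.sum_eq_zero fun i _ =>
    h i (s i) ((tsupport_mul_subset_left).trans (hρ i))

theorem apply_eq_zero_of_disjoint_dsupport {Ω : Opens ℝ} (T : Distr Ω) (t : 𝓓(Ω, ℝ))
    (h : Disjoint (tsupport t) (Distribution.dsupport T)) : T t = 0 := by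
  have hx (x : ℝ) (hx : x ∈ tsupport t) :
      ∃ s : Set ℝ, Distribution.IsVanishingOn T s ∧ IsOpen s ∧ x ∈ s :=
    (Distribution.notMem_dsupport_iff x).1 (Set.disjoint_left.1 h hx)
  choose! s hs ho hm using hx
  obtain ⟨I, hI, hc⟩ := t.hasCompactSupport.isCompact.elim_nhds_subcover s
    (fun x hx => (ho x hx).mem_nhds (hm x hx))
  refine apply_eq_zero_of_cover T (fun i : I => s i) (fun i => ho _ (hI i i.2)) t ?_
    fun i => hs _ (hI i i.2)
  intro x hx
  simpa using hc hx

/-! ### Extension of distributions to `Cⁿ` test functions -/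

open scoped Convolution in
theorem iteratedDeriv_convolution_right {ρ g : ℝ → ℝ} (hρ : LocallyIntegrable ρ volume)
    (hg : HasCompactSupport g) {n : ℕ} (hgn : ContDiff ℝ n g) {j : ℕ} (hj : j ≤ n) :
    iteratedDeriv j (ρ ⋆[ContinuousLinearMap.lsmul ℝ ℝ, volume] g) =
      ρ ⋆[ContinuousLinearMap.lsmul ℝ ℝ, volume] iteratedDeriv j g := by
  induction j generalizing g n with
  | zero => simp
  | succ j ih =>
    obtain ⟨n, rfl⟩ : ∃ m, n = m + 1 := ⟨n - 1, by omega⟩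
    have h1 : ContDiff ℝ 1 g := hgn.of_le (by exact_mod_cast Nat.le_add_left 1 n)
    have hd : deriv (ρ ⋆[ContinuousLinearMap.lsmul ℝ ℝ, volume] g) =
        ρ ⋆[ContinuousLinearMap.lsmul ℝ ℝ, volume] deriv g :=
      funext fun x => (hg.hasDerivAt_convolution_right _ hρ h1 x).deriv
    have h2 : ContDiff ℝ n (deriv g) := by
      have : ContDiff ℝ ((n : WithTop ℕ∞) + 1) g := by exact_mod_cast hgn
      exact (contDiff_succ_iff_deriv.1 this).2.2
    rw [iteratedDeriv_succ', hd, iteratedDeriv_succ', ih hg.deriv h2 (by omega)]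

open scoped Convolution in
/-- Smooth functions are dense in the compactly supported `Cⁿ` functions: two distributions of
order `n` that agree on smooth test functions are equal. -/
theorem ext_of_smooth {n : ℕ} {F₁ F₂ : 𝓓'^{(n : ℕ∞)}((⊤ : Opens ℝ), ℂ)}
    (h : ∀ (t : 𝓓((⊤ : Opens ℝ), ℝ)) (s : 𝓓^{(n : ℕ∞)}((⊤ : Opens ℝ), ℝ)),
      (∀ x, s x = t x) → F₁ s = F₂ s) : F₁ = F₂ := by
  ext s
  have hsn : ContDiff ℝ n s := s.contDiff
  -- the mollifications `u k` of `s` are supported in the common compact set `K`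
  let K : Compacts ℝ := ⟨Metric.cthickening 1 (tsupport s),
    s.hasCompactSupport.isCompact.cthickening⟩
  let φ (k : ℕ) : ContDiffBump (0 : ℝ) := ⟨1 / (2 * ((k : ℝ) + 1)), 1 / ((k : ℝ) + 1),
    by positivity, by
    apply one_div_lt_one_div_of_lt <;> linarith [(Nat.cast_nonneg k : (0 : ℝ) ≤ k)]⟩
  have hout (k : ℕ) : (φ k).rOut = 1 / ((k : ℝ) + 1) := rfl
  have hle (k : ℕ) : (φ k).rOut ≤ 1 := by
    rw [hout, div_le_one (by positivity)]
    linarith [(Nat.cast_nonneg k : (0 : ℝ) ≤ k)]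
  let u (k : ℕ) : ℝ → ℝ := (φ k).normed volume ⋆[ContinuousLinearMap.lsmul ℝ ℝ, volume] s
  have hu (k : ℕ) : ContDiff ℝ ∞ (u k) :=
    (φ k).hasCompactSupport_normed.contDiff_convolution_left (n := ⊤) _ (φ k).contDiff_normed
      (s.continuous.locallyIntegrable)
  have hsupp (k : ℕ) : Function.support (u k) ⊆ K := by
    refine (support_convolution_subset _).trans ?_
    rintro _ ⟨a, ha, b, hb, rfl⟩
    rw [(φ k).support_normed_eq] at ha
    refine Metric.mem_cthickening_of_dist_le _ b _ _ (subset_tsupport _ hb) ?_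
    have : |a| < (φ k).rOut := by simpa using ha
    simpa using this.le.trans (hle k)
  let v (k : ℕ) : 𝓓^{(n : ℕ∞)}_{K}(ℝ, ℝ) :=
    .of_support_subset ((hu k).of_le (by exact_mod_cast le_top)) (hsupp k)
  let s' : 𝓓^{(n : ℕ∞)}_{K}(ℝ, ℝ) := .of_support_subset hsn
    ((subset_tsupport _).trans (Metric.self_subset_cthickening _))
  have hlim : Tendsto v atTop (𝓝 s') := by
    rw [(ContDiffMapSupportedIn.withSeminorms ℝ ℝ ℝ (n : ℕ∞) K).tendsto_nhds]
    intro i ε hε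
    have hφ0 : Tendsto (fun k => (φ k).rOut) atTop (𝓝 0) := tendsto_one_div_add_atTop_nhds_zero_nat
    by_cases hi : i ≤ n
    · have hc : Continuous (iteratedDeriv i s) :=
        hsn.continuous_iteratedDeriv i (by exact_mod_cast hi)
      have huc : UniformContinuous (iteratedDeriv i s) :=
        (HasCompactSupport.intro s.hasCompactSupport.isCompact fun x hx =>
          iteratedDeriv_eq_zero_of_notMem_tsupport hx i).uniformContinuous_of_continuous hc
      obtain ⟨δ, hδ, hd⟩ := Metric.uniformContinuous_iff.1 huc (ε / 2) (by positivity)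
      filter_upwards [hφ0.eventually (gt_mem_nhds hδ)] with k hk
      refine lt_of_le_of_lt ?_ (half_lt_self hε)
      rw [ContDiffMapSupportedIn.seminorm_le_iff ℝ (by positivity)]
      intro _ x _
      rw [norm_iteratedFDeriv_eq_norm_iteratedDeriv]
      have e : iteratedDeriv i (⇑(v k - s')) x = iteratedDeriv i (u k) x - iteratedDeriv i s x :=
        iteratedDeriv_sub ((hu k).of_le (by exact_mod_cast le_top)).contDiffAt
          (hsn.of_le (by exact_mod_cast hi)).contDiffAt
      rw [e, iteratedDeriv_convolution_right
        ((φ k).continuous_normed.locallyIntegrable) s.hasCompactSupport hsn hi, ← dist_eq_norm]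
      exact (φ k).dist_normed_convolution_le hc.aestronglyMeasurable
        fun y hy => (hd (lt_trans (by simpa using hy) hk)).le
    · refine Eventually.of_forall fun k => ?_
      rw [ContDiffMapSupportedIn.seminorm_eq_bot_of_gt ℝ (by exact_mod_cast not_le.1 hi)]
      simpa using hε
  have hK : (K : Set ℝ) ⊆ ((⊤ : Opens ℝ) : Set ℝ) := fun x _ => trivial
  have hcont (F : 𝓓'^{(n : ℕ∞)}((⊤ : Opens ℝ), ℂ)) :
      Tendsto (fun k => F (TestFunction.ofSupportedIn hK (v k))) atTop (𝓝 (F s)) :=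
    ((F.continuous.comp (TestFunction.continuous_ofSupportedIn hK)).tendsto s').comp hlim
  refine tendsto_nhds_unique (hcont F₁) ((hcont F₂).congr fun k => ?_)
  exact (h ⟨u k, hu k, HasCompactSupport.intro K.isCompact
    (Function.support_subset_iff'.1 (hsupp k)), fun x _ => trivial⟩ _ fun x => rfl).symm

/-- The continuous extension of `D^n δ_a` to compactly supported `Cⁿ` functions. -/
def diracExt (n : ℕ) (a : ℝ) : 𝓓'^{(n : ℕ∞)}((⊤ : Opens ℝ), ℂ) :=
  TestFunction.mkCLM ℝ (fun s => (-1) ^ n * ((iteratedDeriv n s a : ℝ) : ℂ))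
    (fun f g => by
      have : iteratedDeriv n (⇑(f + g)) a = iteratedDeriv n f a + iteratedDeriv n g a :=
        iteratedDeriv_add f.contDiff.contDiffAt g.contDiff.contDiffAt
      rw [this]; push_cast; ring)
    (fun c f => by
      have : iteratedDeriv n (⇑(c • f)) a = c * iteratedDeriv n f a :=
        iteratedDeriv_const_mul_field c f
      rw [this, Complex.real_smul]; push_cast; ring)
    (fun K hK => by
      have h : Continuous fun f : 𝓓^{(n : ℕ∞)}_{K}(ℝ, ℝ) =>
          (ContDiffMapSupportedIn.structureMapCLM ℝ (n : ℕ∞) n f) a (fun _ => 1) := by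
        fun_prop
      refine continuous_const.mul (Complex.continuous_ofReal.comp (h.congr fun f => ?_))
      rw [ContDiffMapSupportedIn.structureMapCLM_apply, if_pos le_rfl]
      rfl)

theorem diracExt_apply (n : ℕ) (a : ℝ) (s : 𝓓^{(n : ℕ∞)}((⊤ : Opens ℝ), ℝ)) :
    diracExt n a s = (-1) ^ n * ((iteratedDeriv n s a : ℝ) : ℂ) := rfl

theorem diracExt_eq {n : ℕ} {a : ℝ} (t : 𝓓((⊤ : Opens ℝ), ℝ))
    (s : 𝓓^{(n : ℕ∞)}((⊤ : Opens ℝ), ℝ)) (h : ∀ x, s x = t x) :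
    diracExt n a s = (derivD ⊤ ^ n) (diracAt a) t := by
  rw [diracExt_apply, pow_derivD_diracAt_apply, show (s : ℝ → ℝ) = t from funext h]

/-! ### Primitives with a jump -/

theorem integral_deriv_eq_zero {g : ℝ → ℝ} (hg : ContDiff ℝ 1 g) (hc : HasCompactSupport g) :
    ∫ x, deriv g x = 0 := by
  have hi : Integrable (deriv g) :=
    (hg.continuous_deriv le_rfl).integrable_of_hasCompactSupport hc.deriv
  rw [← intervalIntegral.integral_Iic_add_Ioi (b := 0) hi.integrableOn hi.integrableOn,
    hc.integral_Iic_deriv_eq hg, hc.integral_Ioi_deriv_eq hg, add_neg_cancel]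

theorem _root_.MeasureTheory.LocallyIntegrable.intervalIntegrable {E : Type*}
    [NormedAddCommGroup E] {k : ℝ → E} (hk : LocallyIntegrable k) (a b : ℝ) :
    IntervalIntegrable k volume a b :=
  intervalIntegrable_iff.mpr
    ((hk.integrableOn_isCompact isCompact_uIcc).mono_set Set.uIoc_subset_uIcc)

/-- Integration by parts against a primitive that vanishes at `-∞`, by means of Fubini's theorem;
`k` need not be continuous. -/
theorem integral_deriv_mul_integral_Iio {g : ℝ → ℝ} (hg : ContDiff ℝ 1 g)
    (hc : HasCompactSupport g) {k : ℝ → ℂ} (hk : Integrable k) :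
    ∫ x, ((deriv g x : ℝ) : ℂ) * ∫ y in Set.Iio x, k y = -∫ x, (g x : ℂ) * k x := by
  have hi : Integrable (deriv g) :=
    (hg.continuous_deriv le_rfl).integrable_of_hasCompactSupport hc.deriv
  have hS : MeasurableSet {p : ℝ × ℝ | p.2 < p.1} :=
    measurableSet_lt measurable_snd measurable_fst
  have hF : Integrable (Function.uncurry fun x y : ℝ =>
      (Set.Iio x).indicator (fun y => ((deriv g x : ℝ) : ℂ) * k y) y) (volume.prod volume) := by
    refine ((hi.ofReal (𝕜 := ℂ)).mul_prod hk |>.indicator hS).congr ?_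
    filter_upwards with p
    by_cases h : p.2 < p.1 <;> simp [Function.uncurry, Set.indicator, h]
  have hswap := integral_integral_swap hF
  have e1 (x : ℝ) : ∫ y, (Set.Iio x).indicator (fun y => ((deriv g x : ℝ) : ℂ) * k y) y =
      ((deriv g x : ℝ) : ℂ) * ∫ y in Set.Iio x, k y := by
    rw [integral_indicator measurableSet_Iio, integral_const_mul]
  have e2 (y : ℝ) : ∫ x, (Set.Iio x).indicator (fun y => ((deriv g x : ℝ) : ℂ) * k y) y =
      -((g y : ℂ) * k y) := by
    have : (fun x => (Set.Iio x).indicator (fun y => ((deriv g x : ℝ) : ℂ) * k y) y) =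
        (Set.Ioi y).indicator fun x => ((deriv g x : ℝ) : ℂ) * k y := by
      ext x; by_cases h : y < x <;> simp [Set.indicator, h]
    rw [this, integral_indicator measurableSet_Ioi, integral_mul_const, integral_complex_ofReal,
      hc.integral_Ioi_deriv_eq hg]
    push_cast; ring
  simp_rw [e1, e2] at hswap
  rw [hswap, integral_neg]

/-- Integration by parts against a primitive of a locally integrable function. -/
theorem integral_deriv_mul_primitive {g : ℝ → ℝ} (hg : ContDiff ℝ 1 g)
    (hc : HasCompactSupport g) {k : ℝ → ℂ} (hk : LocallyIntegrable k) (a : ℝ) :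
    ∫ x, ((deriv g x : ℝ) : ℂ) * ∫ y in a..x, k y = -∫ x, (g x : ℂ) * k x := by
  have hi : Integrable (deriv g) :=
    (hg.continuous_deriv le_rfl).integrable_of_hasCompactSupport hc.deriv
  obtain ⟨R, hR⟩ := hc.isCompact.isBounded.subset_closedBall 0
  rw [Real.closedBall_eq_Icc, zero_sub, zero_add] at hR
  -- only the values of `k` on `[-R, R]` matter, and the choice of the base point of the primitive is
  -- immaterial because `∫ deriv g = 0`
  let K := (Set.Icc (-R) R).indicator k
  have hK : Integrable K :=
    (integrable_indicator_iff measurableSet_Icc).2 (hk.integrableOn_isCompact isCompact_Icc)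
  have e1 (x : ℝ) : ((deriv g x : ℝ) : ℂ) * ∫ y in a..x, k y =
      ((deriv g x : ℝ) : ℂ) * (∫ y in Set.Iio x, K y) - deriv g x * ∫ y in (-R)..a, k y := by
    by_cases hx : x ∈ tsupport g
    · obtain ⟨h1, h2⟩ := hR hx
      have : ∫ y in Set.Iio x, K y = ∫ y in (-R)..x, k y := by
        rw [intervalIntegral.integral_of_le h1, ← integral_Icc_eq_integral_Ioc,
          ← integral_Iic_eq_integral_Iio, setIntegral_indicator measurableSet_Icc]
        congr 2
        ext y
        simp only [Set.mem_inter_iff, Set.mem_Iic, Set.mem_Icc]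
        grind
      rw [this, ← mul_sub, intervalIntegral.integral_interval_sub_left
        (hk.intervalIntegrable _ _) (hk.intervalIntegrable _ _)]
    · have : deriv g x = 0 := image_eq_zero_of_notMem_tsupport fun h => hx (tsupport_deriv_subset h)
      simp [this]
  have hm : Integrable fun x => ((deriv g x : ℝ) : ℂ) * ∫ y in Set.Iio x, K y := by
    refine (hi.ofReal (𝕜 := ℂ)).mul_bdd (c := ∫ y, ‖K y‖) ?_ (Eventually.of_forall fun x => ?_)
    · have : (fun x => ∫ y in Set.Iio x, K y) = fun x =>
          (∫ y in Set.Iic (0 : ℝ), K y) + ∫ y in (0 : ℝ)..x, K y := by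
        ext x
        rw [← integral_Iic_eq_integral_Iio, ← intervalIntegral.integral_Iic_sub_Iic
          hK.integrableOn hK.integrableOn]
        ring
      rw [this]
      exact (continuous_const.add (hK.continuous_primitive 0)).aestronglyMeasurable
    · exact (norm_integral_le_integral_norm _).trans
        (setIntegral_le_integral hK.norm (Eventually.of_forall fun _ => norm_nonneg _))
  simp_rw [e1]
  have hI : Integrable fun x => ((deriv g x : ℝ) : ℂ) := hi.ofReal
  rw [integral_sub hm (hI.mul_const _), integral_mul_const,
    integral_complex_ofReal, integral_deriv_eq_zero hg hc,
    integral_deriv_mul_integral_Iio hg hc hK]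
  simp only [Complex.ofReal_zero, zero_mul, sub_zero, neg_inj]
  refine integral_congr_ae (Eventually.of_forall fun x => ?_)
  by_cases hx : x ∈ tsupport g
  · simp [K, hR hx]
  · simp [image_eq_zero_of_notMem_tsupport hx]

/-- The primitive of `k` on `ℝ \ {a}` with right limit `cp` and left limit `cm` at `a`. -/
def jumpPrim (a : ℝ) (k : ℝ → ℂ) (cp cm : ℂ) (x : ℝ) : ℂ :=
  (∫ y in a..x, k y) + if a < x then cp else cm

theorem continuous_primitive {k : ℝ → ℂ} (hk : LocallyIntegrable k) (a : ℝ) :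
    Continuous fun x => ∫ y in a..x, k y :=
  intervalIntegral.continuous_primitive hk.intervalIntegrable a

theorem locallyIntegrable_step (a : ℝ) (cp cm : ℂ) :
    LocallyIntegrable (fun x : ℝ => if a < x then cp else cm) := by
  have : (fun x : ℝ => if a < x then cp else cm) =
      fun x => (Set.Ioi a).indicator (fun _ => cp - cm) x + cm := by
    ext x; by_cases h : a < x <;> simp [h]
  rw [this]
  exact ((locallyIntegrable_const _).indicator measurableSet_Ioi).add (locallyIntegrable_const _)

theorem locallyIntegrable_jumpPrim {k : ℝ → ℂ} (hk : LocallyIntegrable k) (a : ℝ) (cp cm : ℂ) :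
    LocallyIntegrable (jumpPrim a k cp cm) :=
  (continuous_primitive hk a).locallyIntegrable.add (locallyIntegrable_step a cp cm)

theorem integral_deriv_mul_jumpPrim {g : ℝ → ℝ} (hg : ContDiff ℝ 1 g)
    (hc : HasCompactSupport g) {k : ℝ → ℂ} (hk : LocallyIntegrable k) (a : ℝ) (cp cm : ℂ) :
    ∫ x, ((deriv g x : ℝ) : ℂ) * jumpPrim a k cp cm x =
      -((∫ x, (g x : ℂ) * k x) + (cp - cm) * g a) := by
  have hi : Integrable (deriv g) :=
    (hg.continuous_deriv le_rfl).integrable_of_hasCompactSupport hc.deriv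
  have h1 : Integrable fun x => ((deriv g x : ℝ) : ℂ) * ∫ y in a..x, k y :=
    ((Complex.continuous_ofReal.comp (hg.continuous_deriv le_rfl)).mul
      (continuous_primitive hk a)).integrable_of_hasCompactSupport
      ((hc.deriv.comp_left Complex.ofReal_zero).mul_right)
  have e (x : ℝ) : ((deriv g x : ℝ) : ℂ) * (if a < x then cp else cm) =
      (Set.Ioi a).indicator (fun x => ((deriv g x : ℝ) : ℂ) * (cp - cm)) x + deriv g x * cm := by
    by_cases h : a < x <;> simp [h]; ring
  have h2 : Integrable ((Set.Ioi a).indicator (fun x => ((deriv g x : ℝ) : ℂ) * (cp - cm))) :=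
    ((hi.ofReal (𝕜 := ℂ)).mul_const _).indicator measurableSet_Ioi
  have h3 : Integrable fun x => ((deriv g x : ℝ) : ℂ) * cm := (hi.ofReal (𝕜 := ℂ)).mul_const _
  have h4 : Integrable fun x => (Set.Ioi a).indicator
      (fun x => ((deriv g x : ℝ) : ℂ) * (cp - cm)) x + ((deriv g x : ℝ) : ℂ) * cm := h2.add h3
  simp only [jumpPrim, mul_add, e]
  rw [integral_add h1 h4, integral_add h2 h3, integral_deriv_mul_primitive hg hc hk,
    integral_indicator measurableSet_Ioi, integral_mul_const, integral_mul_const,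
    integral_complex_ofReal, integral_complex_ofReal, integral_deriv_eq_zero hg hc,
    hc.integral_Ioi_deriv_eq hg]
  push_cast; ring

theorem testFunction_contDiff_one {Ω : Opens ℝ} (t : 𝓓(Ω, ℝ)) : ContDiff ℝ 1 t :=
  t.contDiff.of_le (by exact_mod_cast le_top)

theorem derivD_regDistr_apply {Ω : Opens ℝ} {f : ℝ → ℂ} (hf : LocallyIntegrableOn f Ω)
    (t : 𝓓(Ω, ℝ)) : derivD Ω (regDistr Ω f) t = -∫ x, ((deriv t x : ℝ) : ℂ) * f x := by
  rw [derivD_apply, regDistr_apply hf, coe_lineDeriv_testFunction]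

/-- The distributional derivative of a piecewise primitive of `k` is `k` plus the jump times
`δ_a`. -/
theorem derivD_regDistr_jumpPrim {k : ℝ → ℂ} (hk : LocallyIntegrable k) (a : ℝ) (cp cm : ℂ) :
    derivD ⊤ (regDistr ⊤ (jumpPrim a k cp cm)) = regDistr ⊤ k + (cp - cm) • diracAt a := by
  ext t
  have e : (regDistr ⊤ k + (cp - cm) • diracAt a) t =
    regDistr ⊤ k t + (cp - cm) * diracAt a t := rfl
  rw [e, derivD_regDistr_apply ((locallyIntegrable_jumpPrim hk _ _ _).locallyIntegrableOn _),
    integral_deriv_mul_jumpPrim (testFunction_contDiff_one t) t.hasCompactSupport hk,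
    regDistr_apply (hk.locallyIntegrableOn _), neg_neg, diracAt_apply]

/-- Away from `a` there is no jump to be seen. -/
theorem derivD_regDistr_jumpPrim_of_notMem {Ω : Opens ℝ} {k : ℝ → ℂ} (hk : LocallyIntegrable k)
    {a : ℝ} (ha : a ∉ Ω) (cp cm : ℂ) :
    derivD Ω (regDistr Ω (jumpPrim a k cp cm)) = regDistr Ω k := by
  ext t
  rw [derivD_regDistr_apply ((locallyIntegrable_jumpPrim hk _ _ _).locallyIntegrableOn _),
    integral_deriv_mul_jumpPrim (testFunction_contDiff_one t) t.hasCompactSupport hk,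
    regDistr_apply (hk.locallyIntegrableOn _),
    image_eq_zero_of_notMem_tsupport fun h => ha (t.tsupport_subset h)]
  simp

/-! ### Functions that are regular off a point -/

/-- `f` is locally integrable, of class `Cⁿ` off the point `a`, and for `j ≤ n` its `j`-th
derivative has the right limit `l j` and the left limit `m j` at `a`. -/
structure RegularOff (n : ℕ) (f : ℝ → ℂ) (a : ℝ) (l m : ℕ → ℂ) : Prop where
  locallyIntegrable : LocallyIntegrable f
  contDiffOn : ContDiffOn ℝ n f {a}ᶜ
  right : ∀ j ≤ n, Tendsto (iteratedDeriv j f) (𝓝[>] a) (𝓝 (l j))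
  left : ∀ j ≤ n, Tendsto (iteratedDeriv j f) (𝓝[<] a) (𝓝 (m j))

theorem RegularOff.isPiecewiseC {n : ℕ} {f : ℝ → ℂ} {a : ℝ} {l m : ℕ → ℂ}
    (h : RegularOff n f a l m) : IsPiecewiseC n f :=
  ⟨{a}, by simpa using h.contDiffOn, fun x hx j hj => by
    obtain rfl := Finset.mem_singleton.1 hx
    exact ⟨⟨_, h.right j hj⟩, _, h.left j hj⟩⟩

theorem RegularOff.contDiffAt {n : ℕ} {f : ℝ → ℂ} {a : ℝ} {l m : ℕ → ℂ}
    (h : RegularOff n f a l m) {x : ℝ} (hx : x ≠ a) : ContDiffAt ℝ n f x :=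
  h.contDiffOn.contDiffAt (isOpen_compl_singleton.mem_nhds hx)

theorem regularOff_zero (n : ℕ) (a : ℝ) : RegularOff n (fun _ => 0) a 0 0 where
  locallyIntegrable := locallyIntegrable_zero
  contDiffOn := contDiffOn_const
  right j _ := by
    have : iteratedDeriv j (fun _ : ℝ => (0 : ℂ)) = fun _ => 0 := by ext x; simp
    rw [this]; exact tendsto_const_nhds
  left j _ := by
    have : iteratedDeriv j (fun _ : ℝ => (0 : ℂ)) = fun _ => 0 := by ext x; simp
    rw [this]; exact tendsto_const_nhds

theorem RegularOff.comp_add_const {n : ℕ} {f : ℝ → ℂ} {a : ℝ} {l m : ℕ → ℂ}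
    (h : RegularOff n f a l m) (ε : ℝ) : RegularOff n (fun x => f (x + ε)) (a - ε) l m where
  locallyIntegrable := by
    intro x
    obtain ⟨s, hs, hi⟩ := h.locallyIntegrable (x + ε)
    refine ⟨(fun y => y + ε) ⁻¹' s, (continuous_add_const ε).continuousAt hs, ?_⟩
    exact ((measurePreserving_add_right volume ε).integrableOn_comp_preimage
      (measurableEmbedding_addRight ε)).2 hi
  contDiffOn := h.contDiffOn.comp (contDiff_id.add contDiff_const).contDiffOn fun x hx => by
    simp only [Set.mem_compl_iff, Set.mem_singleton_iff] at hx ⊢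
    contrapose! hx; simp [← hx]
  right j hj := by
    rw [iteratedDeriv_comp_add_const]
    refine (h.right j hj).comp (tendsto_nhdsWithin_iff.2 ⟨?_, ?_⟩)
    · exact ((continuous_add_const ε).tendsto' (a - ε) a (by simp)).mono_left nhdsWithin_le_nhds
    · filter_upwards [self_mem_nhdsWithin] with x hx
      simpa [sub_lt_iff_lt_add] using hx
  left j hj := by
    rw [iteratedDeriv_comp_add_const]
    refine (h.left j hj).comp (tendsto_nhdsWithin_iff.2 ⟨?_, ?_⟩)
    · exact ((continuous_add_const ε).tendsto' (a - ε) a (by simp)).mono_left nhdsWithin_le_nhds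
    · filter_upwards [self_mem_nhdsWithin] with x hx
      simpa [lt_sub_iff_add_lt] using hx

theorem tendsto_jumpPrim_right {k : ℝ → ℂ} (hk : LocallyIntegrable k) (a : ℝ) (cp cm : ℂ) :
    Tendsto (jumpPrim a k cp cm) (𝓝[>] a) (𝓝 cp) := by
  have h : Tendsto (fun x => (∫ y in a..x, k y) + cp) (𝓝[>] a) (𝓝 cp) :=
    (((continuous_primitive hk a).add continuous_const).tendsto' a cp (by simp)).mono_left
      nhdsWithin_le_nhds
  refine h.congr' ?_
  filter_upwards [self_mem_nhdsWithin] with x hx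
  rw [jumpPrim, if_pos (Set.mem_Ioi.1 hx)]

theorem tendsto_jumpPrim_left {k : ℝ → ℂ} (hk : LocallyIntegrable k) (a : ℝ) (cp cm : ℂ) :
    Tendsto (jumpPrim a k cp cm) (𝓝[<] a) (𝓝 cm) := by
  have h : Tendsto (fun x => (∫ y in a..x, k y) + cm) (𝓝[<] a) (𝓝 cm) :=
    (((continuous_primitive hk a).add continuous_const).tendsto' a cm (by simp)).mono_left
      nhdsWithin_le_nhds
  refine h.congr' ?_
  filter_upwards [self_mem_nhdsWithin] with x hx
  rw [jumpPrim, if_neg (not_lt.2 (le_of_lt hx))]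

theorem jumpPrim_eventuallyEq {k : ℝ → ℂ} {a x : ℝ} (cp cm : ℂ) (hx : x ≠ a) :
    jumpPrim a k cp cm =ᶠ[𝓝 x]
      fun y => (∫ z in a..y, k z) + if a < x then cp else cm := by
  rcases lt_or_gt_of_ne hx with h | h
  · filter_upwards [gt_mem_nhds h] with y hy
    simp [jumpPrim, not_lt.2 hy.le, not_lt.2 h.le]
  · filter_upwards [lt_mem_nhds h] with y hy
    simp [jumpPrim, hy, h]

theorem regularOff_jumpPrim_zero {k : ℝ → ℂ} (hk : LocallyIntegrable k) (a : ℝ) (cp cm : ℂ) :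
    RegularOff 0 (jumpPrim a k cp cm) a (fun _ => cp) (fun _ => cm) where
  locallyIntegrable := locallyIntegrable_jumpPrim hk _ _ _
  contDiffOn := by
    rw [Nat.cast_zero, contDiffOn_zero]
    intro x hx
    refine (ContinuousAt.congr ?_ (jumpPrim_eventuallyEq cp cm hx).symm).continuousWithinAt
    exact ((continuous_primitive hk a).add continuous_const).continuousAt
  right j hj := by
    obtain rfl := Nat.le_zero.1 hj
    simpa using tendsto_jumpPrim_right hk a cp cm
  left j hj := by
    obtain rfl := Nat.le_zero.1 hj
    simpa using tendsto_jumpPrim_left hk a cp cm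

theorem RegularOff.hasDerivAt_jumpPrim {n : ℕ} {k : ℝ → ℂ} {a : ℝ} {l m : ℕ → ℂ}
    (h : RegularOff n k a l m) (cp cm : ℂ) {x : ℝ} (hx : x ≠ a) :
    HasDerivAt (jumpPrim a k cp cm) (k x) x := by
  refine HasDerivAt.congr_of_eventuallyEq ?_ (jumpPrim_eventuallyEq cp cm hx)
  refine HasDerivAt.add_const _ (intervalIntegral.integral_hasDerivAt_right
    (h.locallyIntegrable.intervalIntegrable _ _) ?_ (h.contDiffAt hx).continuousAt)
  exact h.contDiffOn.continuousOn.stronglyMeasurableAtFilter isOpen_compl_singleton x hx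

/-- Taking a primitive raises the regularity by one; the sequences of one-sided limits are shifted,
with `cp` and `cm` as their new members of index `0`. -/
theorem RegularOff.jumpPrim {n : ℕ} {k : ℝ → ℂ} {a : ℝ} {l m : ℕ → ℂ}
    (h : RegularOff n k a l m) (cp cm : ℂ) :
    RegularOff (n + 1) (jumpPrim a k cp cm) a (fun j => Nat.casesOn j cp l)
      (fun j => Nat.casesOn j cm m) := by
  have hd (x : ℝ) (hx : x ≠ a) : deriv (PointInteraction.jumpPrim a k cp cm) =ᶠ[𝓝 x] k := by
    filter_upwards [isOpen_compl_singleton.mem_nhds hx] with y hy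
    exact (h.hasDerivAt_jumpPrim cp cm hy).deriv
  have hj (j : ℕ) (x : ℝ) (hx : x ≠ a) : iteratedDeriv j k x =
      iteratedDeriv (j + 1) (PointInteraction.jumpPrim a k cp cm) x := by
    rw [iteratedDeriv_succ', (hd x hx).iteratedDeriv_eq]
  refine ⟨locallyIntegrable_jumpPrim h.locallyIntegrable _ _ _, ?_, ?_, ?_⟩
  · rw [Nat.cast_add, Nat.cast_one, contDiffOn_succ_iff_deriv_of_isOpen isOpen_compl_singleton]
    refine ⟨fun x hx => (h.hasDerivAt_jumpPrim cp cm hx).differentiableAt.differentiableWithinAt,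
      by simp, h.contDiffOn.congr fun x hx => (h.hasDerivAt_jumpPrim cp cm hx).deriv⟩
  · rintro (_ | j) hle
    · simpa using tendsto_jumpPrim_right h.locallyIntegrable a cp cm
    · refine (h.right j (by omega)).congr' ?_
      filter_upwards [self_mem_nhdsWithin] with x hx using hj j x (ne_of_gt hx)
  · rintro (_ | j) hle
    · simpa using tendsto_jumpPrim_left h.locallyIntegrable a cp cm
    · refine (h.left j (by omega)).congr' ?_
      filter_upwards [self_mem_nhdsWithin] with x hx using hj j x (ne_of_lt hx)

/-! ### Order and support of combinations of derivatives of Dirac measures -/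

/-- `δ_a` is the derivative of the Heaviside function at `a`. -/
theorem diracAt_eq_derivD (a : ℝ) :
    diracAt a = derivD ⊤ (regDistr ⊤ (jumpPrim a (fun _ => 0) 1 0)) := by
  rw [derivD_regDistr_jumpPrim locallyIntegrable_zero]
  ext t
  have e : (regDistr ⊤ (fun _ => 0) + ((1 : ℂ) - 0) • diracAt a) t =
    regDistr ⊤ (fun _ => 0) t + ((1 : ℂ) - 0) * diracAt a t := rfl
  rw [e, regDistr_apply (locallyIntegrable_zero.locallyIntegrableOn _)]
  simp

/-- A distribution of order at most `m` is the `m`-th derivative of a regular distribution, since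
locally integrable functions have primitives. -/
theorem OrderLE.exists_eq {m : ℕ} {F : Distr ⊤} (h : OrderLE m F) :
    ∃ f : ℝ → ℂ, LocallyIntegrable f ∧ F = (derivD ⊤ ^ m) (regDistr ⊤ f) := by
  obtain ⟨k, hk, f, hf, rfl⟩ := h
  induction m, hk using Nat.le_induction with
  | base => exact ⟨f, hf, rfl⟩
  | succ m _ ih =>
    obtain ⟨g, hg, e⟩ := ih
    refine ⟨jumpPrim 0 g 0 0, locallyIntegrable_jumpPrim hg _ _ _, ?_⟩
    have h0 : (0 : ℂ) • diracAt 0 = 0 := by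
      ext t
      exact zero_mul (diracAt 0 t)
    rw [e, pow_succ, Module.End.mul_apply, derivD_regDistr_jumpPrim hg, sub_self, h0, add_zero]

theorem integrable_testFunction_mul {Ω : Opens ℝ} {f : ℝ → ℂ} (hf : LocallyIntegrableOn f Ω)
    (t : 𝓓(Ω, ℝ)) : Integrable fun x => (t x : ℂ) * f x := by
  simpa using TestFunction.integrable_bilin (ContinuousLinearMap.lsmul ℝ ℝ) hf t

theorem regDistr_add {Ω : Opens ℝ} {f g : ℝ → ℂ} (hf : LocallyIntegrableOn f Ω)
    (hg : LocallyIntegrableOn g Ω) :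
    regDistr Ω (fun x => f x + g x) = regDistr Ω f + regDistr Ω g := by
  ext t
  have e : (regDistr Ω f + regDistr Ω g) t = regDistr Ω f t + regDistr Ω g t := rfl
  have hfg : LocallyIntegrableOn (fun x => f x + g x) Ω := hf.add hg
  rw [e, regDistr_apply hfg, regDistr_apply hf, regDistr_apply hg,
    ← integral_add (integrable_testFunction_mul hf t) (integrable_testFunction_mul hg t)]
  simp only [mul_add]

theorem regDistr_const_mul {Ω : Opens ℝ} {f : ℝ → ℂ} (hf : LocallyIntegrableOn f Ω) (c : ℂ) :
    regDistr Ω (fun x => c * f x) = c • regDistr Ω f := by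
  ext t
  have e : (c • regDistr Ω f) t = c * regDistr Ω f t := rfl
  have hcf : LocallyIntegrableOn (fun x => c * f x) Ω := hf.smul c
  rw [e, regDistr_apply hcf, regDistr_apply hf, ← integral_const_mul]
  simp only [mul_left_comm]

theorem OrderLE.add {m : ℕ} {F G : Distr ⊤} (hF : OrderLE m F) (hG : OrderLE m G) :
    OrderLE m (F + G) := by
  obtain ⟨f, hf, rfl⟩ := hF.exists_eq
  obtain ⟨g, hg, rfl⟩ := hG.exists_eq
  exact ⟨m, le_rfl, _, hf.add hg, by
    rw [← map_add, ← regDistr_add (hf.locallyIntegrableOn _) (hg.locallyIntegrableOn _)]; rfl⟩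

theorem OrderLE.smul {m : ℕ} {F : Distr ⊤} (hF : OrderLE m F) (c : ℂ) : OrderLE m (c • F) := by
  obtain ⟨k, hk, f, hf, rfl⟩ := hF
  exact ⟨k, hk, fun x => c * f x, hf.smul c, by
    rw [← map_smul, ← regDistr_const_mul (hf.locallyIntegrableOn _)]⟩

theorem orderLE_zero (m : ℕ) : OrderLE m 0 :=
  ⟨0, m.zero_le, fun _ => 0, locallyIntegrable_zero, by
    ext t
    rw [pow_zero, Module.End.one_apply,
      regDistr_apply (locallyIntegrable_zero.locallyIntegrableOn _)]
    simp⟩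

theorem orderLE_pow_derivD_diracAt {k n : ℕ} (h : k ≤ n) (a : ℝ) :
    OrderLE (n + 1) ((derivD ⊤ ^ k) (diracAt a)) :=
  ⟨k + 1, by omega, _, locallyIntegrable_jumpPrim locallyIntegrable_zero a 1 0, by
    rw [diracAt_eq_derivD, pow_succ, Module.End.mul_apply]⟩

theorem dsupport_subset_singleton {T : Distr ⊤} {a : ℝ}
    (h : ∀ t : 𝓓((⊤ : Opens ℝ), ℝ), a ∉ tsupport t → T t = 0) :
    Distribution.dsupport T ⊆ {a} := fun x hx =>
  (Distribution.mem_dsupport_iff x).1 hx {a}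
    (fun t ht => h t fun ha => ht ha rfl) isClosed_singleton

theorem pow_derivD_diracAt_apply_eq_zero {n : ℕ} {a : ℝ} {t : 𝓓((⊤ : Opens ℝ), ℝ)}
    (h : a ∉ tsupport t) : (derivD ⊤ ^ n) (diracAt a) t = 0 := by
  rw [pow_derivD_diracAt_apply, iteratedDeriv_eq_zero_of_notMem_tsupport h]
  simp

/-- The product of `D^n δ_a` by a function whose derivatives at `a` are `c j`, written with the
Leibniz rule as a combination of derivatives of `δ_a`. -/
def diracMul (n : ℕ) (a : ℝ) (c : ℕ → ℂ) : Distr ⊤ :=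
  ∑ j ∈ Finset.range (n + 1),
    ((-1) ^ j * (n.choose j : ℂ) * c j) • (derivD ⊤ ^ (n - j)) (diracAt a)

theorem diracMul_apply (n : ℕ) (a : ℝ) (c : ℕ → ℂ) (t : 𝓓((⊤ : Opens ℝ), ℝ)) :
    diracMul n a c t = (-1) ^ n * ∑ j ∈ Finset.range (n + 1),
      (n.choose j : ℂ) * c j * ((iteratedDeriv (n - j) t a : ℝ) : ℂ) := by
  rw [diracMul, FunLike.coe_sum, Finset.sum_apply, Finset.mul_sum]
  refine Finset.sum_congr rfl fun j hj => ?_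
  have hj : j ≤ n := Nat.lt_succ_iff.1 (Finset.mem_range.1 hj)
  change ((-1) ^ j * (n.choose j : ℂ) * c j) * (derivD ⊤ ^ (n - j)) (diracAt a) t = _
  obtain ⟨i, rfl⟩ := Nat.exists_eq_add_of_le hj
  have h1 : ((-1 : ℂ) ^ j) * (-1) ^ j = 1 := by rw [← mul_pow]; simp
  rw [pow_derivD_diracAt_apply, Nat.add_sub_cancel_left, pow_add]
  ring

theorem diracMul_apply_eq_zero {n : ℕ} {a : ℝ} (c : ℕ → ℂ) {t : 𝓓((⊤ : Opens ℝ), ℝ)}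
    (h : a ∉ tsupport t) : diracMul n a c t = 0 := by
  rw [diracMul_apply]
  simp [iteratedDeriv_eq_zero_of_notMem_tsupport h]

theorem orderLE_diracMul (n : ℕ) (a : ℝ) (c : ℕ → ℂ) : OrderLE (n + 1) (diracMul n a c) :=
  Finset.sum_induction _ _ (fun _ _ => OrderLE.add) (orderLE_zero _) fun _ _ =>
    (orderLE_pow_derivD_diracAt (Nat.sub_le _ _) a).smul _

theorem memA_of_dsupport {n : ℕ} {f : ℝ → ℂ} {Δ : Distr ⊤} {a : ℝ} (hf : IsPiecewiseC n f)
    (hs : ∀ t : 𝓓((⊤ : Opens ℝ), ℝ), a ∉ tsupport t → Δ t = 0) (ho : OrderLE (n + 1) Δ) :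
    MemA n (regDistr ⊤ f + Δ) :=
  ⟨f, Δ, hf, (Set.finite_singleton a).subset (dsupport_subset_singleton hs), ho, rfl⟩

theorem regDistr_zero : regDistr ⊤ (fun _ => 0) = 0 := by
  ext t
  rw [regDistr_apply (locallyIntegrable_zero.locallyIntegrableOn _)]
  simp

theorem memA_diracMul (n : ℕ) (a : ℝ) (c : ℕ → ℂ) : MemA n (diracMul n a c) := by
  have := memA_of_dsupport (regularOff_zero n a).isPiecewiseC
    (fun t => diracMul_apply_eq_zero c) (orderLE_diracMul n a c)
  rwa [regDistr_zero, zero_add] at this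

/-! ### Distributions with a single singular point -/

/-- The distribution `f + κ D^n δ_a`. -/
def singular (n : ℕ) (f : ℝ → ℂ) (κ : ℂ) (a : ℝ) : Distr ⊤ :=
  regDistr ⊤ f + κ • (derivD ⊤ ^ n) (diracAt a)

theorem singular_zero_one (n : ℕ) (a : ℝ) :
    singular n (fun _ => 0) 1 a = (derivD ⊤ ^ n) (diracAt a) := by
  rw [singular, regDistr_zero, zero_add, one_smul]

theorem singular_apply {n : ℕ} {f : ℝ → ℂ} (hf : LocallyIntegrable f) (κ : ℂ) (a : ℝ)
    (t : 𝓓((⊤ : Opens ℝ), ℝ)) : singular n f κ a t =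
      (∫ x, (t x : ℂ) * f x) + κ * ((-1) ^ n * ((iteratedDeriv n t a : ℝ) : ℂ)) := by
  rw [← regDistr_apply (hf.locallyIntegrableOn _), ← pow_derivD_diracAt_apply]
  rfl

theorem RegularOff.memA_singular {n : ℕ} {f : ℝ → ℂ} {a : ℝ} {l m : ℕ → ℂ}
    (h : RegularOff n f a l m) (κ : ℂ) : MemA n (singular n f κ a) :=
  memA_of_dsupport (a := a) h.isPiecewiseC
    (fun t ht => by
      change κ * (derivD ⊤ ^ n) (diracAt a) t = 0
      rw [pow_derivD_diracAt_apply_eq_zero ht, mul_zero])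
    ((orderLE_pow_derivD_diracAt le_rfl a).smul κ)

theorem singular_restrictsTo {n : ℕ} {f : ℝ → ℂ} (hf : LocallyIntegrable f) (κ : ℂ) (a : ℝ) :
    RestrictsTo (singular n f κ a) {a}ᶜ f := fun t ht => by
  rw [singular_apply hf, iteratedDeriv_eq_zero_of_notMem_tsupport fun h => ht h rfl]
  simp

theorem RegularOff.nSingSupp_singular_subset {n : ℕ} {f : ℝ → ℂ} {a : ℝ} {l m : ℕ → ℂ}
    (h : RegularOff n f a l m) (κ : ℂ) : nSingSupp n (singular n f κ a) ⊆ {a} := by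
  intro x hx
  by_contra hxa
  exact hx ⟨{a}ᶜ, ⟨isOpen_compl_singleton, f, h.contDiffOn,
    singular_restrictsTo h.locallyIntegrable κ a⟩, hxa⟩

theorem exists_singular_extension (n : ℕ) {f : ℝ → ℂ} (hf : LocallyIntegrable f) (κ : ℂ) (a : ℝ) :
    ∃ F' : 𝓓'^{(n : ℕ∞)}((⊤ : Opens ℝ), ℂ),
      ∀ (t : 𝓓((⊤ : Opens ℝ), ℝ)) (s : 𝓓^{(n : ℕ∞)}((⊤ : Opens ℝ), ℝ)),
        (∀ x, s x = t x) → F' s = singular n f κ a t := by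
  let I : 𝓓^{(n : ℕ∞)}((⊤ : Opens ℝ), ℝ) →L[ℝ] ℂ :=
    TestFunction.integralAgainstBilinCLM (ContinuousLinearMap.lsmul ℝ ℝ) volume f
  let D : 𝓓^{(n : ℕ∞)}((⊤ : Opens ℝ), ℝ) →L[ℝ] ℂ := diracExt n a
  refine ⟨(I + κ • D : 𝓓^{(n : ℕ∞)}((⊤ : Opens ℝ), ℝ) →L[ℝ] ℂ), fun t s h => ?_⟩
  change I s + κ * diracExt n a s = regDistr ⊤ f t + κ * (derivD ⊤ ^ n) (diracAt a) t
  have e : I s = ∫ x, ContinuousLinearMap.lsmul ℝ ℝ (s x) (f x) :=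
    TestFunction.integralAgainstBilinCLM_eq_integral (hf.locallyIntegrableOn _)
  rw [diracExt_eq t s h, e, regDistr_apply (hf.locallyIntegrableOn _)]
  simp [h]

/-- Translation by `ε` of test functions: `t ↦ t(x - ε)`. -/
def translateTest (ε : ℝ) (t : 𝓓((⊤ : Opens ℝ), ℝ)) : 𝓓((⊤ : Opens ℝ), ℝ) :=
  ⟨fun x => t (x - ε), t.contDiff.comp (contDiff_id.sub contDiff_const),
    t.hasCompactSupport.comp_homeomorph (Homeomorph.subRight ε), fun _ _ => trivial⟩

theorem singular_translate {n : ℕ} {f : ℝ → ℂ} (hf : LocallyIntegrable f)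
    {ε : ℝ} (hf' : LocallyIntegrable fun x => f (x + ε)) (κ : ℂ) (a : ℝ)
    {t t' : 𝓓((⊤ : Opens ℝ), ℝ)} (h : ∀ x, t' x = t (x - ε)) :
    singular n (fun x => f (x + ε)) κ (a - ε) t = singular n f κ a t' := by
  rw [singular_apply hf, singular_apply hf']
  have e1 : ∫ x, (t' x : ℂ) * f x = ∫ x, (t x : ℂ) * f (x + ε) := by
    rw [← integral_add_right_eq_self _ ε]
    simp [h]
  have e2 : iteratedDeriv n t' a = iteratedDeriv n t (a - ε) := by
    rw [show (t' : ℝ → ℝ) = fun x => t (x - ε) from funext h, iteratedDeriv_comp_sub_const]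
  rw [e1, e2]

theorem isTranslate_singular_iff {n : ℕ} {f : ℝ → ℂ} (hf : LocallyIntegrable f)
    {ε : ℝ} (hf' : LocallyIntegrable fun x => f (x + ε)) (κ : ℂ) (a : ℝ) {G : Distr ⊤} :
    IsTranslate ε (singular n f κ a) G ↔ G = singular n (fun x => f (x + ε)) κ (a - ε) := by
  constructor
  · intro h
    ext t
    rw [h t (translateTest ε t) fun x => rfl,
      singular_translate hf hf' κ a (t' := translateTest ε t) fun x => rfl]
  · rintro rfl t t' h
    exact singular_translate hf hf' κ a h

/-! ### The Hörmander product of a Dirac measure with a distribution that is regular there -/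

theorem IsHormanderProd.symm {n : ℕ} {F G P : Distr ⊤} (h : IsHormanderProd n F G P) :
    IsHormanderProd n G F P := by
  obtain ⟨hF, hG, hd, hP, d, Ξ, hc, hi⟩ := h
  exact ⟨hG, hF, hd.symm, hP, d, Ξ, hc, fun i => (hi i).symm⟩

/-- A distribution coincides with at most one continuous function on an open set. -/
theorem RestrictsTo.eqOn {G : Distr ⊤} {U : Set ℝ} (hU : IsOpen U) {f g : ℝ → ℂ}
    (hf : ContinuousOn f U) (hg : ContinuousOn g U) (h₁ : RestrictsTo G U f)
    (h₂ : RestrictsTo G U g) : Set.EqOn f g U := by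
  have lf := hf.locallyIntegrableOn (μ := volume) hU.measurableSet
  have lg := hg.locallyIntegrableOn (μ := volume) hU.measurableSet
  have h0 : ∀ᵐ x, x ∈ U → f x - g x = 0 := by
    refine hU.ae_eq_zero_of_integral_contDiff_smul_eq_zero (lf.sub lg) fun s hs hc hsU => ?_
    let t : 𝓓((⟨U, hU⟩ : Opens ℝ), ℝ) := ⟨s, by exact_mod_cast hs, hc, hsU⟩
    let t' : 𝓓((⊤ : Opens ℝ), ℝ) := ⟨s, by exact_mod_cast hs, hc, fun _ _ => trivial⟩
    have i1 : Integrable (fun x => (s x : ℂ) * f x) := integrable_testFunction_mul lf t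
    have i2 : Integrable (fun x => (s x : ℂ) * g x) := integrable_testFunction_mul lg t
    simp only [Complex.real_smul, mul_sub]
    rw [integral_sub i1 i2, sub_eq_zero]
    exact (h₁ t' hsU).symm.trans (h₂ t' hsU)
  refine Measure.eqOn_open_of_ae_eq (μ := volume) ?_ hU hf hg
  rw [Filter.EventuallyEq, ae_restrict_iff' hU.measurableSet]
  filter_upwards [h0] with x hx hxU using sub_eq_zero.1 (hx hxU)

/-- An open set on which `D^n δ_a` is a continuous function does not contain `a`, and the function
vanishes there. -/
theorem notMem_of_diracAt_restrictsTo {n : ℕ} {a : ℝ} {U : Set ℝ} (hU : IsOpen U) {f : ℝ → ℂ}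
    (hf : ContinuousOn f U) (h : RestrictsTo ((derivD ⊤ ^ n) (diracAt a)) U f) :
    a ∉ U ∧ Set.EqOn f 0 U := by
  have hV : IsOpen (U ∩ {a}ᶜ) := hU.inter isOpen_compl_singleton
  have h0 : Set.EqOn f 0 (U ∩ {a}ᶜ) := by
    refine RestrictsTo.eqOn hV (hf.mono Set.inter_subset_left) continuousOn_const
      (fun t ht => h t (ht.trans Set.inter_subset_left)) fun t ht => ?_
    rw [pow_derivD_diracAt_apply_eq_zero fun ha => (ht ha).2 rfl]
    simp
  have ha : a ∉ U := by
    intro ha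
    obtain ⟨r, hr, hrU⟩ := Metric.isOpen_iff.1 hU a ha
    let φ : ContDiffBump a := ⟨r / 4, r / 2, by positivity, by linarith⟩
    -- `D^n δ_a` takes the value `(-1)^n n!` at a test function that is `(x - a)^n` near `a`
    let t : 𝓓((⊤ : Opens ℝ), ℝ) := ⟨fun x => (x - a) ^ n * φ x,
      ((contDiff_id.sub contDiff_const).pow n).mul φ.contDiff, φ.hasCompactSupport.mul_left,
      fun _ _ => trivial⟩
    have ht : tsupport t ⊆ U := by
      refine (tsupport_mul_subset_right.trans ?_).trans hrU
      rw [φ.tsupport_eq]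
      exact Metric.closedBall_subset_ball (by change r / 2 < r; linarith)
    have e1 : (derivD ⊤ ^ n) (diracAt a) t = 0 := by
      rw [h t ht]
      refine integral_eq_zero_of_ae ?_
      filter_upwards [compl_mem_ae_iff.2 (measure_singleton a)] with x hx
      by_cases hxt : x ∈ tsupport t
      · simp [h0 ⟨ht hxt, hx⟩]
      · simp [image_eq_zero_of_notMem_tsupport hxt]
    have e2 : iteratedDeriv n t a = n.factorial := by
      have : (t : ℝ → ℝ) =ᶠ[𝓝 a] fun x => (x - a) ^ n := by
        filter_upwards [φ.eventuallyEq_one] with x hx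
        change (x - a) ^ n * φ x = _
        rw [hx]; simp
      rw [this.iteratedDeriv_eq, iteratedDeriv_comp_sub_const n (fun x : ℝ => x ^ n)]
      simp [Nat.descFactorial_self]
    rw [pow_derivD_diracAt_apply, e2] at e1
    have : ((n.factorial : ℝ) : ℂ) ≠ 0 := by exact_mod_cast n.factorial_ne_zero
    exact (mul_ne_zero (pow_ne_zero _ (by norm_num)) this) e1
  exact ⟨ha, fun x hx => h0 ⟨hx, fun h => ha (h ▸ hx)⟩⟩

theorem iteratedDeriv_ofReal {s : ℝ → ℝ} {n : ℕ} (hs : ContDiff ℝ n s) :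
    iteratedDeriv n (fun x => (s x : ℂ)) = fun x => ((iteratedDeriv n s x : ℝ) : ℂ) := by
  induction n generalizing s with
  | zero => simp
  | succ n ih =>
    have h : ContDiff ℝ ((n : WithTop ℕ∞) + 1) s := by exact_mod_cast hs
    obtain ⟨h1, _, h2⟩ := contDiff_succ_iff_deriv.1 h
    have e : deriv (fun x => (s x : ℂ)) = fun x => ((deriv s x : ℝ) : ℂ) :=
      funext fun x => (h1 x).hasDerivAt.ofReal_comp.deriv
    rw [iteratedDeriv_succ', e, ih h2, iteratedDeriv_succ']

theorem contDiff_ofReal {s : ℝ → ℝ} {n : WithTop ℕ∞} (hs : ContDiff ℝ n s) :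
    ContDiff ℝ n fun x => (s x : ℂ) :=
  Complex.ofRealCLM.contDiff.comp hs

theorem iteratedDeriv_re_add_im {n : ℕ} {s₁ s₂ : ℝ → ℝ} (h₁ : ContDiff ℝ n s₁)
    (h₂ : ContDiff ℝ n s₂) (a : ℝ) :
    iteratedDeriv n (fun x => (s₁ x : ℂ) + s₂ x * Complex.I) a =
      ((iteratedDeriv n s₁ a : ℝ) : ℂ) + ((iteratedDeriv n s₂ a : ℝ) : ℂ) * Complex.I := by
  rw [iteratedDeriv_fun_add (contDiff_ofReal h₁).contDiffAt
    ((contDiff_ofReal h₂).mul contDiff_const).contDiffAt,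
    iteratedDeriv_mul_const_field (fun x => (s₂ x : ℂ)), iteratedDeriv_ofReal h₁,
    iteratedDeriv_ofReal h₂]

theorem diracMul_apply_of_contDiffAt {n : ℕ} {a : ℝ} {g : ℝ → ℂ} (hg : ContDiffAt ℝ n g a)
    (t : 𝓓((⊤ : Opens ℝ), ℝ)) : diracMul n a (fun j => iteratedDeriv j g a) t =
      (-1) ^ n * iteratedDeriv n (fun x => g x * (t x : ℂ)) a := by
  have ht (m : ℕ) : ContDiff ℝ m t := t.contDiff.of_le (by exact_mod_cast le_top)
  rw [diracMul_apply, iteratedDeriv_fun_mul hg (contDiff_ofReal (ht n)).contDiffAt]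
  simp only [iteratedDeriv_ofReal (ht _)]

/-- A `Cⁿ` function on an open set times a test function supported there is `Cⁿ` on the line. -/
theorem contDiff_mul_testFunction {n : ℕ} {U : Set ℝ} (hU : IsOpen U) {g : ℝ → ℂ}
    (hg : ContDiffOn ℝ n g U) {t : 𝓓((⊤ : Opens ℝ), ℝ)} (ht : tsupport t ⊆ U) :
    ContDiff ℝ n fun x => g x * (t x : ℂ) := by
  rw [contDiff_iff_contDiffAt]
  intro x
  by_cases hx : x ∈ tsupport t
  · exact (hg.contDiffAt (hU.mem_nhds (ht hx))).mul
      (contDiff_ofReal (t.contDiff.of_le (by exact_mod_cast le_top))).contDiffAt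
  · refine (contDiffAt_const (c := (0 : ℂ))).congr_of_eventuallyEq ?_
    filter_upwards [notMem_tsupport_iff_eventuallyEq.1 hx] with y hy
    simp [hy]

/-- The real and imaginary parts of `g t` as `Cⁿ` test functions. -/
theorem exists_re_im_mul_testFunction {n : ℕ} {U : Set ℝ} (hU : IsOpen U) {g : ℝ → ℂ}
    (hg : ContDiffOn ℝ n g U) {t : 𝓓((⊤ : Opens ℝ), ℝ)} (ht : tsupport t ⊆ U) :
    ∃ s₁ s₂ : 𝓓^{(n : ℕ∞)}((⊤ : Opens ℝ), ℝ),
      ∀ x, (s₁ x : ℂ) + s₂ x * Complex.I = g x * t x := by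
  have h := contDiff_mul_testFunction hU hg ht
  have hc : HasCompactSupport fun x => g x * (t x : ℂ) :=
    (t.hasCompactSupport.comp_left Complex.ofReal_zero).mul_left
  exact ⟨⟨fun x => (g x * (t x : ℂ)).re, Complex.reCLM.contDiff.comp h,
      hc.comp_left Complex.zero_re, fun _ _ => trivial⟩,
    ⟨fun x => (g x * (t x : ℂ)).im, Complex.imCLM.contDiff.comp h,
      hc.comp_left Complex.zero_im, fun _ _ => trivial⟩, fun x => Complex.re_add_im _⟩

theorem diracExt_re_add_im {n : ℕ} {a : ℝ} {g : ℝ → ℂ} {t : 𝓓((⊤ : Opens ℝ), ℝ)}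
    {s₁ s₂ : 𝓓^{(n : ℕ∞)}((⊤ : Opens ℝ), ℝ)}
    (h : ∀ x, (s₁ x : ℂ) + s₂ x * Complex.I = g x * t x) :
    diracExt n a s₁ + diracExt n a s₂ * Complex.I =
      (-1) ^ n * iteratedDeriv n (fun x => g x * (t x : ℂ)) a := by
  rw [← funext h, iteratedDeriv_re_add_im s₁.contDiff s₂.contDiff, diracExt_apply, diracExt_apply]
  ring

/-- The product of `D^n δ_a` with a distribution that is the `Cⁿ` function `g` near `a`. -/
theorem IsHormanderProd.eq_diracMul {n : ℕ} {a : ℝ} {G P : Distr ⊤}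
    (h : IsHormanderProd n ((derivD ⊤ ^ n) (diracAt a)) G P) {U : Set ℝ} (hU : IsOpen U)
    (ha : a ∈ U) {g : ℝ → ℂ} (hg : ContDiffOn ℝ n g U) (hG : RestrictsTo G U g) :
    P = diracMul n a fun j => iteratedDeriv j g a := by
  obtain ⟨-, -, -, -, d, Ξ, hc, hi⟩ := h
  have key (i : Fin d) (t : 𝓓((⊤ : Opens ℝ), ℝ)) (ht : tsupport t ⊆ Ξ i) :
      P t = diracMul n a (fun j => iteratedDeriv j g a) t := by
    rcases hi i with ⟨g', hg', hGg', F', hF', hP⟩ | ⟨f, hf, hFf, F', hF', hP⟩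
    · obtain ⟨s₁, s₂, hs⟩ := exists_re_im_mul_testFunction (Ξ i).isOpen hg' ht
      have hF : F' = diracExt n a :=
        ext_of_smooth fun t s hst => (hF' t s hst).trans (diracExt_eq t s hst).symm
      rw [hP t s₁ s₂ ht hs, hF, diracExt_re_add_im hs,
        diracMul_apply_of_contDiffAt (hg.contDiffAt (hU.mem_nhds ha))]
      congr 1
      refine Filter.EventuallyEq.iteratedDeriv_eq n ?_
      by_cases hai : a ∈ Ξ i
      · have hV : IsOpen (U ∩ Ξ i) := hU.inter (Ξ i).isOpen
        have heq : Set.EqOn g' g (U ∩ Ξ i) := RestrictsTo.eqOn hV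
          (hg'.continuousOn.mono Set.inter_subset_right)
          (hg.continuousOn.mono Set.inter_subset_left)
          (fun t ht => hGg' t (ht.trans Set.inter_subset_right))
          (fun t ht => hG t (ht.trans Set.inter_subset_left))
        filter_upwards [hV.mem_nhds ⟨ha, hai⟩] with x hx
        rw [heq hx]
      · filter_upwards [notMem_tsupport_iff_eventuallyEq.1 fun h => hai (ht h)] with x hx
        simp [hx]
    · obtain ⟨hai, hf0⟩ := notMem_of_diracAt_restrictsTo (Ξ i).isOpen hf.continuousOn hFf
      rw [diracMul_apply_eq_zero _ fun h => hai (ht h), hP t 0 0 ht]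
      · simp
      · intro x
        by_cases hx : x ∈ tsupport t
        · simp [hf0 (ht hx)]
        · simp [image_eq_zero_of_notMem_tsupport hx]
  ext t
  refine sub_eq_zero.1 (apply_eq_zero_of_cover (P - diracMul n a fun j => iteratedDeriv j g a)
    (fun i => (Ξ i : Set ℝ)) (fun i => (Ξ i).isOpen) t (by rw [hc]; exact Set.subset_univ _)
    fun i t ht => sub_eq_zero.2 (key i t ht))

/-- For `b ≠ a` the Hörmander product of `D^n δ_b` with `f + κ D^n δ_a` exists, and it depends only on
the derivatives of `f` at `b`. -/
theorem RegularOff.isHormanderProd_iff {n : ℕ} {f : ℝ → ℂ} {a b : ℝ} {l m : ℕ → ℂ}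
    (h : RegularOff n f a l m) (κ : ℂ) (hab : b ≠ a) {P : Distr ⊤} :
    IsHormanderProd n ((derivD ⊤ ^ n) (diracAt b)) (singular n f κ a) P ↔
      P = diracMul n b fun j => iteratedDeriv j f b := by
  have hG := singular_restrictsTo (n := n) h.locallyIntegrable κ a
  refine ⟨fun hP => hP.eq_diracMul isOpen_compl_singleton hab h.contDiffOn hG, ?_⟩
  rintro rfl
  have hF := regularOff_zero n b
  have hsF := hF.nSingSupp_singular_subset 1
  have hmF := hF.memA_singular 1
  have hrF := singular_restrictsTo (n := n) hF.locallyIntegrable 1 b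
  rw [singular_zero_one] at hsF hmF hrF
  refine ⟨hmF, h.memA_singular κ, ?_, memA_diracMul _ _ _, 2,
    ![⟨{a}ᶜ, isOpen_compl_singleton⟩, ⟨{b}ᶜ, isOpen_compl_singleton⟩], ?_, fun i => ?_⟩
  · exact Set.disjoint_of_subset hsF (h.nSingSupp_singular_subset κ) (by simpa using hab)
  · ext x
    simp only [Set.mem_iUnion, Set.mem_univ, iff_true, Fin.exists_fin_two]
    by_cases hx : x = a
    · exact Or.inr fun hb => hab (hb.symm.trans hx)
    · exact Or.inl hx
  · fin_cases i
    · refine Or.inl ⟨f, h.contDiffOn, hG, diracExt n b, fun t s hst => diracExt_eq t s hst,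
        fun t s₁ s₂ _ hs => ?_⟩
      rw [diracExt_re_add_im hs, diracMul_apply_of_contDiffAt (h.contDiffAt hab)]
    · obtain ⟨F', hF'⟩ := exists_singular_extension n h.locallyIntegrable κ a
      refine Or.inr ⟨fun _ => 0, contDiffOn_const, hrF, F', hF', fun t s₁ s₂ ht hs => ?_⟩
      have hs₁ : s₁ = 0 := by
        ext x; simpa using congrArg Complex.re (hs x)
      have hs₂ : s₂ = 0 := by
        ext x; simpa using congrArg Complex.im (hs x)
      rw [diracMul_apply_eq_zero _ fun h => ht h rfl, hs₁, hs₂]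
      simp

/-! ### The product `*` with derivatives of the Dirac measure -/

theorem isTranslate_diracAt_iff {n : ℕ} {ε : ℝ} (a : ℝ) {G : Distr ⊤} :
    IsTranslate ε ((derivD ⊤ ^ n) (diracAt a)) G ↔ G = (derivD ⊤ ^ n) (diracAt (a - ε)) := by
  rw [← singular_zero_one, ← singular_zero_one]
  exact isTranslate_singular_iff locallyIntegrable_zero locallyIntegrable_zero 1 a

theorem memA_diracAt (n : ℕ) (a : ℝ) : MemA n ((derivD ⊤ ^ n) (diracAt a)) := by
  rw [← singular_zero_one]
  exact (regularOff_zero n a).memA_singular 1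

theorem ext_of_tendsto {P P' : Distr ⊤} {Q Q' : ℝ → Distr ⊤}
    (hQ : ∀ t, Tendsto (fun ε => Q ε t) (𝓝[>] 0) (𝓝 (P t)))
    (hQ' : ∀ t, Tendsto (fun ε => Q' ε t) (𝓝[>] 0) (𝓝 (P' t)))
    (h : ∀ᶠ ε in 𝓝[>] (0 : ℝ), Q ε = Q' ε) : P = P' := by
  ext t
  refine tendsto_nhds_unique (hQ t) ((hQ' t).congr' ?_)
  filter_upwards [h] with ε hε
  rw [hε]

theorem tendsto_diracMul {n : ℕ} {a : ℝ → ℝ} {c : ℝ → ℕ → ℂ} {b : ℝ} {l : ℕ → ℂ} {L : Filter ℝ}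
    (ha : Tendsto a L (𝓝 b)) (hc : ∀ j ≤ n, Tendsto (fun ε => c ε j) L (𝓝 (l j)))
    (t : 𝓓((⊤ : Opens ℝ), ℝ)) :
    Tendsto (fun ε => diracMul n (a ε) (c ε) t) L (𝓝 (diracMul n b l t)) := by
  simp only [diracMul_apply]
  refine Tendsto.const_mul _ (tendsto_finsetSum _ fun j hj => ?_)
  refine Tendsto.mul ((hc j (Nat.lt_succ_iff.1 (Finset.mem_range.1 hj))).const_mul _) ?_
  have ht (m : ℕ) : ContDiff ℝ m t := t.contDiff.of_le (by exact_mod_cast le_top)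
  have : Continuous (iteratedDeriv (n - j) t) :=
    (ht (n - j)).continuous_iteratedDeriv _ le_rfl
  exact ((Complex.continuous_ofReal.comp this).tendsto b).comp ha

/-- `δ⁽ⁿ⁾ * F` sees the right limits of `F` at the origin: for `ε > 0` the translate `F(x + ε)` is
regular there, and its derivatives at the origin are those of `F` at `ε`. -/
theorem RegularOff.isStarProd_dirac_left_iff {n : ℕ} {f : ℝ → ℂ} {l m : ℕ → ℂ}
    (h : RegularOff n f 0 l m) (κ : ℂ) {P : Distr ⊤} :
    IsStarProd n ((derivD ⊤ ^ n) dirac) (singular n f κ 0) P ↔ P = diracMul n 0 l := by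
  let Q (ε : ℝ) : Distr ⊤ := diracMul n 0 fun j => iteratedDeriv j f ε
  have hQ (ε : ℝ) (hε : 0 < ε) (G P' : Distr ⊤) (hG : IsTranslate ε (singular n f κ 0) G) :
      IsHormanderProd n ((derivD ⊤ ^ n) dirac) G P' ↔ P' = Q ε := by
    have hε' := h.comp_add_const ε
    rw [isTranslate_singular_iff h.locallyIntegrable hε'.locallyIntegrable] at hG
    rw [hG, ← diracAt_zero, hε'.isHormanderProd_iff κ (by simpa using hε.ne')]
    simp [Q, iteratedDeriv_comp_add_const]
  have hlim (t) : Tendsto (fun ε => Q ε t) (𝓝[>] 0) (𝓝 (diracMul n 0 l t)) :=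
    tendsto_diracMul tendsto_const_nhds h.right t
  constructor
  · rintro ⟨-, -, Q', hQ', hl⟩
    refine ext_of_tendsto hl hlim ?_
    filter_upwards [hQ', self_mem_nhdsWithin] with ε ⟨G, hG, hP⟩ hε
    exact (hQ ε hε G _ hG).1 hP
  · rintro rfl
    refine ⟨memA_diracAt n 0, h.memA_singular κ, Q, ?_, hlim⟩
    filter_upwards [self_mem_nhdsWithin] with ε hε
    have hG := (isTranslate_singular_iff (n := n) h.locallyIntegrable
      (h.comp_add_const ε).locallyIntegrable κ 0).2 rfl
    exact ⟨_, hG, (hQ ε hε _ _ hG).2 rfl⟩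

/-- `F * δ⁽ⁿ⁾` sees the left limits of `F` at the origin, the translates of `δ⁽ⁿ⁾` being
supported at `-ε`. -/
theorem RegularOff.isStarProd_dirac_right_iff {n : ℕ} {f : ℝ → ℂ} {l m : ℕ → ℂ}
    (h : RegularOff n f 0 l m) (κ : ℂ) {P : Distr ⊤} :
    IsStarProd n (singular n f κ 0) ((derivD ⊤ ^ n) dirac) P ↔ P = diracMul n 0 m := by
  let Q (ε : ℝ) : Distr ⊤ := diracMul n (0 - ε) fun j => iteratedDeriv j f (0 - ε)
  have hQ (ε : ℝ) (hε : 0 < ε) (G P' : Distr ⊤)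
      (hG : IsTranslate ε ((derivD ⊤ ^ n) (diracAt 0)) G) :
      IsHormanderProd n (singular n f κ 0) G P' ↔ P' = Q ε := by
    rw [isTranslate_diracAt_iff] at hG
    rw [hG, ← h.isHormanderProd_iff κ (by simpa using hε.ne')]
    exact ⟨IsHormanderProd.symm, IsHormanderProd.symm⟩
  have ht : Tendsto (fun ε : ℝ => 0 - ε) (𝓝[>] 0) (𝓝[<] 0) := by
    refine tendsto_nhdsWithin_iff.2 ⟨?_, ?_⟩
    · exact ((continuous_const.sub continuous_id).tendsto' 0 0 (by simp)).mono_left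
        nhdsWithin_le_nhds
    · filter_upwards [self_mem_nhdsWithin] with x hx
      simpa using hx
  have hlim (t) : Tendsto (fun ε => Q ε t) (𝓝[>] 0) (𝓝 (diracMul n 0 m t)) :=
    tendsto_diracMul (ht.mono_right nhdsWithin_le_nhds) (fun j hj => (h.left j hj).comp ht) t
  rw [← diracAt_zero]
  constructor
  · rintro ⟨-, -, Q', hQ', hl⟩
    refine ext_of_tendsto hl hlim ?_
    filter_upwards [hQ', self_mem_nhdsWithin] with ε ⟨G, hG, hP⟩ hε
    exact (hQ ε hε G _ hG).1 hP
  · rintro rfl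
    refine ⟨h.memA_singular κ, memA_diracAt n 0, Q, ?_, hlim⟩
    filter_upwards [self_mem_nhdsWithin] with ε hε
    have hG := (isTranslate_diracAt_iff (n := n) (ε := ε) 0).2 rfl
    exact ⟨_, hG, (hQ ε hε _ _ hG).2 rfl⟩

theorem RegularOff.isBeta_iff {n : ℕ} {f : ℝ → ℂ} {l m : ℕ → ℂ}
    (h : RegularOff n f 0 l m) (κ : ℂ) {V : Distr ⊤} :
    IsBeta n (singular n f κ 0) V ↔ V = diracMul n 0 l - diracMul n 0 m := by
  simp [IsBeta, h.isStarProd_dirac_left_iff, h.isStarProd_dirac_right_iff]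

/-! ### Distributions with a locally integrable second derivative on an interval -/

/-- A distribution on an interval whose derivative vanishes is constant. -/
theorem exists_eq_const_of_derivD_eq_zero {Ω : Opens ℝ} (hΩ : (Ω : Set ℝ).OrdConnected)
    (hne : (Ω : Set ℝ).Nonempty) {T : Distr Ω} (hT : derivD Ω T = 0) :
    ∃ c : ℂ, T = regDistr Ω fun _ => c := by
  obtain ⟨x₀, hx₀⟩ := hne
  obtain ⟨r, hr, hrΩ⟩ := Metric.isOpen_iff.1 Ω.isOpen x₀ hx₀
  let φ : ContDiffBump x₀ := ⟨r / 4, r / 2, by positivity, by linarith⟩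
  have hφs : tsupport (φ.normed volume) ⊆ Ω := by
    rw [φ.tsupport_normed_eq]
    exact (Metric.closedBall_subset_ball (by change r / 2 < r; linarith)).trans hrΩ
  let θ : 𝓓(Ω, ℝ) := ⟨φ.normed volume, φ.contDiff_normed, φ.hasCompactSupport_normed, hφs⟩
  have hθ : ∫ x, θ x = 1 := φ.integral_normed
  refine ⟨T θ, ?_⟩
  ext t
  -- `t` and `(∫ t) θ` have the same integral, so that their difference is a derivative
  let s : 𝓓(Ω, ℝ) := t - (∫ x, t x) • θ
  have hsx (x : ℝ) : s x = t x - (∫ x, t x) * θ x := rfl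
  have hti : Integrable t := t.continuous.integrable_of_hasCompactSupport t.hasCompactSupport
  have hθi : Integrable θ := θ.continuous.integrable_of_hasCompactSupport θ.hasCompactSupport
  have hs0 : ∫ x, s x = 0 := by
    simp_rw [hsx]
    rw [integral_sub hti (hθi.const_mul _), integral_const_mul, hθ, mul_one, sub_self]
  have hK : IsCompact (insert x₀ (tsupport s)) := s.hasCompactSupport.isCompact.insert x₀
  have hKne : (insert x₀ (tsupport s)).Nonempty := Set.insert_nonempty _ _
  have hKΩ : insert x₀ (tsupport s) ⊆ Ω := Set.insert_subset hx₀ s.tsupport_subset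
  set m := sInf (insert x₀ (tsupport s))
  set M := sSup (insert x₀ (tsupport s))
  have hmM : Set.Icc m M ⊆ Ω := hΩ.out (hKΩ (hK.sInf_mem hKne)) (hKΩ (hK.sSup_mem hKne))
  have hsupp : tsupport s ⊆ Set.Icc m M := fun x hx =>
    ⟨csInf_le hK.bddBelow (Set.mem_insert_of_mem _ hx),
      le_csSup hK.bddAbove (Set.mem_insert_of_mem _ hx)⟩
  have hzero {x : ℝ} (hx : x ∉ Set.Icc m M) : s x = 0 :=
    image_eq_zero_of_notMem_tsupport fun h => hx (hsupp h)
  let S (x : ℝ) : ℝ := ∫ y in Set.Iic x, s y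
  have hsi : Integrable s := s.continuous.integrable_of_hasCompactSupport s.hasCompactSupport
  have hS : ∀ x, HasDerivAt S (s x) x := fun x => by
    have h := intervalIntegral.integral_hasDerivAt_right (a := 0) (b := x)
      hsi.intervalIntegrable
      s.continuous.stronglyMeasurable.stronglyMeasurableAtFilter s.continuous.continuousAt
    refine (h.const_add (∫ y in Set.Iic (0 : ℝ), s y)).congr_of_eventuallyEq
      (Eventually.of_forall fun y => ?_)
    change ∫ z in Set.Iic y, s z = (∫ z in Set.Iic (0 : ℝ), s z) + ∫ z in (0 : ℝ)..y, s z
    rw [← intervalIntegral.integral_Iic_sub_Iic hsi.integrableOn hsi.integrableOn]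
    ring
  have hSsupp : Function.support S ⊆ Set.Icc m M := by
    refine Function.support_subset_iff'.2 fun x hx => ?_
    rcases lt_or_ge x m with h | h
    · exact setIntegral_eq_zero_of_forall_eq_zero fun y hy =>
        hzero fun hym => (lt_of_le_of_lt hy h).not_ge hym.1
    · have hMx : M < x := lt_of_not_ge fun h' => hx ⟨h, h'⟩
      refine (setIntegral_eq_integral_of_forall_compl_eq_zero fun y hy => ?_).trans hs0
      exact hzero fun hym => hy (hym.2.trans hMx.le)
  have hScd : ContDiff ℝ ∞ S := contDiff_infty_iff_deriv.2
    ⟨fun x => (hS x).differentiableAt, by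
      rw [funext fun x => (hS x).deriv]
      exact s.contDiff⟩
  let S' : 𝓓(Ω, ℝ) := ⟨S, hScd, HasCompactSupport.intro isCompact_Icc
    (Function.support_subset_iff'.1 hSsupp),
    (closure_minimal hSsupp isClosed_Icc).trans hmM⟩
  have hds : (∂_{(1 : ℝ)} S' : 𝓓(Ω, ℝ)) = s := by
    ext x
    rw [lineDeriv_testFunction_apply]
    exact (hS x).deriv
  have hTs : T s = 0 := by
    have := derivD_apply T S'
    rw [hT, hds] at this
    simpa using this.symm
  have hTt : T t = (∫ x, t x) • T θ := by
    rw [← map_smul, ← sub_eq_zero, ← map_sub]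
    exact hTs
  rw [hTt, regDistr_apply (locallyIntegrable_const _ |>.locallyIntegrableOn _),
    integral_mul_const, integral_complex_ofReal, Complex.real_smul]

theorem ae_eq_of_regDistr_eq {Ω : Opens ℝ} {f g : ℝ → ℂ} (hf : LocallyIntegrableOn f Ω)
    (hg : LocallyIntegrableOn g Ω) (h : regDistr Ω f = regDistr Ω g) :
    ∀ᵐ x, x ∈ Ω → f x = g x := by
  have h0 : ∀ᵐ x, x ∈ (Ω : Set ℝ) → f x - g x = 0 := by
    refine Ω.isOpen.ae_eq_zero_of_integral_contDiff_smul_eq_zero (hf.sub hg) fun s hs hc hsU => ?_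
    let t : 𝓓(Ω, ℝ) := ⟨s, by exact_mod_cast hs, hc, hsU⟩
    have i1 : Integrable (fun x => (s x : ℂ) * f x) := integrable_testFunction_mul hf t
    have i2 : Integrable (fun x => (s x : ℂ) * g x) := integrable_testFunction_mul hg t
    simp only [Complex.real_smul, mul_sub]
    rw [integral_sub i1 i2, sub_eq_zero]
    have := congrArg (fun T : Distr Ω => T t) h
    simp only [regDistr_apply hf, regDistr_apply hg] at this
    exact this
  filter_upwards [h0] with x hx hxΩ using sub_eq_zero.1 (hx hxΩ)

theorem regDistr_congr {Ω : Opens ℝ} {f g : ℝ → ℂ} (hf : LocallyIntegrableOn f Ω)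
    (hg : LocallyIntegrableOn g Ω) (h : ∀ᵐ x, x ∈ Ω → f x = g x) :
    regDistr Ω f = regDistr Ω g := by
  ext t
  rw [regDistr_apply hf, regDistr_apply hg]
  refine integral_congr_ae ?_
  filter_upwards [h] with x hx
  by_cases hxt : x ∈ tsupport t
  · simp only [hx (t.tsupport_subset hxt)]
  · simp [image_eq_zero_of_notMem_tsupport hxt]

/-- On an interval, a distribution whose derivative is a function is a primitive of it. -/
theorem exists_eq_regDistr_jumpPrim {Ω : Opens ℝ} (hΩ : (Ω : Set ℝ).OrdConnected)
    (hne : (Ω : Set ℝ).Nonempty) {a : ℝ} (ha : a ∉ Ω) {T : Distr Ω} {k : ℝ → ℂ}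
    (hk : LocallyIntegrable k) (hT : derivD Ω T = regDistr Ω k) :
    ∃ c : ℂ, T = regDistr Ω (jumpPrim a k c c) := by
  have h0 : derivD Ω (T - regDistr Ω (jumpPrim a k 0 0)) = 0 := by
    rw [map_sub, hT, derivD_regDistr_jumpPrim_of_notMem hk ha, sub_self]
  obtain ⟨c, hc⟩ := exists_eq_const_of_derivD_eq_zero hΩ hne h0
  refine ⟨c, ?_⟩
  rw [sub_eq_iff_eq_add.1 hc, ← regDistr_add ((locallyIntegrable_const c).locallyIntegrableOn _)
    ((locallyIntegrable_jumpPrim hk a 0 0).locallyIntegrableOn _)]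
  congr 1
  ext x
  simp [jumpPrim, add_comm]

/-- On one side of the origin only the constants that belong to this side matter. -/
theorem jumpPrim_jumpPrim_eq {φ : ℝ → ℂ} {d cp cm dp dm : ℂ} {x : ℝ}
    (h : ∀ y ∈ Set.uIoc 0 x, d = if 0 < y then dp else dm) (c : ℂ)
    (hc : c = if 0 < x then cp else cm) :
    jumpPrim 0 (jumpPrim 0 φ d d) c c x = jumpPrim 0 (jumpPrim 0 φ dp dm) cp cm x := by
  rw [jumpPrim, jumpPrim, ite_self, hc]
  congr 1
  refine intervalIntegral.integral_congr_ae (Eventually.of_forall fun y hy => ?_)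
  rw [jumpPrim, jumpPrim, ite_self, h y hy]

/-- If `ψ'' = φ` on both half-lines, then `ψ` is a twofold piecewise primitive of `φ`. -/
theorem exists_ae_eq_jumpPrim {ψ φ : ℝ → ℂ} (hψ : LocallyIntegrable ψ) (hφ : LocallyIntegrable φ)
    (hn : derivD negHalf (derivD negHalf (regDistr negHalf ψ)) = regDistr negHalf φ)
    (hp : derivD posHalf (derivD posHalf (regDistr posHalf ψ)) = regDistr posHalf φ) :
    ∃ dp dm cp cm : ℂ, ψ =ᵐ[volume] jumpPrim 0 (jumpPrim 0 φ dp dm) cp cm := by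
  have key {Ω : Opens ℝ} (hΩ : (Ω : Set ℝ).OrdConnected) (hne : (Ω : Set ℝ).Nonempty)
      (h0 : (0 : ℝ) ∉ Ω) (h : derivD Ω (derivD Ω (regDistr Ω ψ)) = regDistr Ω φ) :
      ∃ d c : ℂ, ∀ᵐ x, x ∈ Ω → ψ x = jumpPrim 0 (jumpPrim 0 φ d d) c c x := by
    obtain ⟨d, hd⟩ := exists_eq_regDistr_jumpPrim hΩ hne h0 hφ h
    have hk := locallyIntegrable_jumpPrim hφ 0 d d
    obtain ⟨c, hc⟩ := exists_eq_regDistr_jumpPrim hΩ hne h0 hk hd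
    exact ⟨d, c, ae_eq_of_regDistr_eq (hψ.locallyIntegrableOn _)
      ((locallyIntegrable_jumpPrim hk 0 c c).locallyIntegrableOn _) hc⟩
  obtain ⟨dm, cm, hm⟩ := key (Ω := negHalf) Set.ordConnected_Iio ⟨-1, by simp [negHalf]⟩
    (lt_irrefl (0 : ℝ)) hn
  obtain ⟨dp, cp, hp⟩ := key (Ω := posHalf) Set.ordConnected_Ioi ⟨1, by simp [posHalf]⟩
    (lt_irrefl (0 : ℝ)) hp
  refine ⟨dp, dm, cp, cm, ?_⟩
  filter_upwards [hm, hp, compl_mem_ae_iff.2 (measure_singleton (0 : ℝ))] with x h1 h2 hx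
  rcases lt_or_gt_of_ne hx with h | h
  · rw [h1 h]
    refine jumpPrim_jumpPrim_eq (fun y hy => ?_) _ (if_neg h.not_gt).symm
    rw [Set.uIoc_of_ge h.le] at hy
    exact (if_neg hy.2.not_gt).symm
  · rw [h2 h]
    refine jumpPrim_jumpPrim_eq (fun y hy => ?_) _ (if_pos h).symm
    rw [Set.uIoc_of_le h.le] at hy
    exact (if_pos hy.1).symm

/-! ### Square integrability of the first derivative -/

open scoped Convolution in
/-- The integrals of an `L²` function over windows of length one form an `L²` function. -/
theorem memLp_window {φ : ℝ → ℂ} (hφ : MemLp φ 2) :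
    MemLp (fun x => ∫ y in x..x + 1, ‖φ y‖) 2 := by
  have hsq : Integrable fun y => ‖φ y‖ ^ 2 := hφ.integrable_norm_pow (by norm_num)
  have hloc : LocallyIntegrable fun y => ‖φ y‖ :=
    hφ.norm.locallyIntegrable (by norm_num)
  have hii := hloc.intervalIntegrable
  have hcont : Continuous fun x => ∫ y in x..x + 1, ‖φ y‖ := by
    have : (fun x => ∫ y in x..x + 1, ‖φ y‖) =
        fun x => (∫ y in (0 : ℝ)..x + 1, ‖φ y‖) - ∫ y in (0 : ℝ)..x, ‖φ y‖ := by
      ext x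
      rw [intervalIntegral.integral_interval_sub_left (hii _ _) (hii _ _)]
    rw [this]
    exact ((intervalIntegral.continuous_primitive hii 0).comp (continuous_add_const 1)).sub
      (intervalIntegral.continuous_primitive hii 0)
  rw [memLp_two_iff_integrable_sq hcont.aestronglyMeasurable]
  have hg : Integrable ((Set.Ico (-1 : ℝ) 0).indicator fun _ => (1 : ℝ)) :=
    (integrable_indicator_iff measurableSet_Ico).2 (by simp)
  have hM := hsq.integrable_convolution (ContinuousLinearMap.mul ℝ ℝ) hg
  have hMx (x : ℝ) : ((fun y => ‖φ y‖ ^ 2) ⋆[ContinuousLinearMap.mul ℝ ℝ, volume]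
      (Set.Ico (-1 : ℝ) 0).indicator fun _ => (1 : ℝ)) x = ∫ y in x..x + 1, ‖φ y‖ ^ 2 := by
    rw [intervalIntegral.integral_of_le (by linarith), ← integral_indicator measurableSet_Ioc]
    refine integral_congr_ae (Eventually.of_forall fun y => ?_)
    have : x - y ∈ Set.Ico (-1 : ℝ) 0 ↔ y ∈ Set.Ioc x (x + 1) := by
      simp only [Set.mem_Ico, Set.mem_Ioc]; constructor <;> rintro ⟨h1, h2⟩ <;>
        constructor <;> linarith
    by_cases hy : y ∈ Set.Ioc x (x + 1)
    · simp [Set.indicator_of_mem hy, Set.indicator_of_mem (this.2 hy)]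
    · simp [Set.indicator_of_notMem hy, Set.indicator_of_notMem (mt this.1 hy)]
  refine hM.mono' (hcont.pow 2).aestronglyMeasurable (Eventually.of_forall fun x => ?_)
  rw [hMx, Real.norm_of_nonneg (sq_nonneg _)]
  -- the variance of `‖φ‖` on the window is nonnegative
  set N := ∫ y in x..x + 1, ‖φ y‖
  have h0 : 0 ≤ ∫ y in x..x + 1, (‖φ y‖ - N) ^ 2 :=
    intervalIntegral.integral_nonneg (by linarith) fun y _ => sq_nonneg _
  have e : ∫ y in x..x + 1, (‖φ y‖ - N) ^ 2 = (∫ y in x..x + 1, ‖φ y‖ ^ 2) - N ^ 2 := by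
    have e1 : (fun y => (‖φ y‖ - N) ^ 2) = fun y => (‖φ y‖ ^ 2 - 2 * N * ‖φ y‖) + N ^ 2 := by
      ext y; ring
    rw [e1, intervalIntegral.integral_add (hsq.intervalIntegrable.sub ((hii _ _).const_mul _))
      intervalIntegrable_const, intervalIntegral.integral_sub hsq.intervalIntegrable
      ((hii _ _).const_mul _), intervalIntegral.integral_const_mul]
    simp only [intervalIntegral.integral_const, add_sub_cancel_left, one_smul]
    change _ - 2 * N * N + N ^ 2 = _
    ring
  linarith

/-- The derivative `k` of `u` at a point of the window `[x, x + 1]` is bounded by the increment of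
`u` over the window, which is the mean value of `k` there, and the integral of `|k'|`. The window
must not contain the point `0`, where `k` and `u` may jump. -/
theorem norm_jumpPrim_le {φ : ℝ → ℂ} (hφ : LocallyIntegrable φ) (dp dm cp cm : ℂ) {x z : ℝ}
    (hz : z ∈ Set.Icc x (x + 1)) (hside : 0 < x ∨ x + 1 < 0) :
    ‖jumpPrim 0 φ dp dm z‖ ≤ ‖jumpPrim 0 (jumpPrim 0 φ dp dm) cp cm (x + 1)‖ +
      ‖jumpPrim 0 (jumpPrim 0 φ dp dm) cp cm x‖ + ∫ y in x..x + 1, ‖φ y‖ := by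
  set k := jumpPrim 0 φ dp dm with hkdef
  have hk : LocallyIntegrable k := locallyIntegrable_jumpPrim hφ _ _ _
  have hstep {α : Type} (p q : α) (y : ℝ) (hy : y ∈ Set.Icc x (x + 1)) :
      (if 0 < y then p else q) = if 0 < z then p else q := by
    rcases hside with h | h
    · rw [if_pos (h.trans_le hy.1), if_pos (h.trans_le hz.1)]
    · rw [if_neg (hy.2.trans_lt h).not_gt, if_neg (hz.2.trans_lt h).not_gt]
  have hu : ∫ y in x..x + 1, k y =
      jumpPrim 0 k cp cm (x + 1) - jumpPrim 0 k cp cm x := by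
    rw [jumpPrim, jumpPrim, hstep cp cm (x + 1) ⟨by linarith, le_rfl⟩,
      hstep cp cm x ⟨le_rfl, by linarith⟩, add_sub_add_right_eq_sub,
      intervalIntegral.integral_interval_sub_left (hk.intervalIntegrable _ _)
        (hk.intervalIntegrable _ _)]
  have hd : ‖∫ y in x..x + 1, (k y - k z)‖ ≤ ∫ y in x..x + 1, ‖φ y‖ := by
    have := intervalIntegral.norm_integral_le_of_norm_le_const (a := x) (b := x + 1)
      (f := fun y => k y - k z) (C := ∫ y in x..x + 1, ‖φ y‖) fun y hy => ?_
    · simpa using this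
    rw [Set.uIoc_of_le (by linarith)] at hy
    have e : k y - k z = ∫ w in z..y, φ w := by
      rw [hkdef, jumpPrim, jumpPrim, hstep dp dm y ⟨hy.1.le, hy.2⟩, add_sub_add_right_eq_sub,
        intervalIntegral.integral_interval_sub_left (hφ.intervalIntegrable _ _)
          (hφ.intervalIntegrable _ _)]
    rw [e]
    refine intervalIntegral.norm_integral_le_integral_norm_uIoc.trans ?_
    rw [intervalIntegral.integral_of_le (by linarith)]
    refine setIntegral_mono_set ?_ (Eventually.of_forall fun _ => norm_nonneg _) ?_
    · exact ((hφ.integrableOn_isCompact (isCompact_Icc (a := x) (b := x + 1))).mono_set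
        Set.Ioc_subset_Icc_self).norm
    · exact LE.le.eventuallyLE (Set.Ioc_subset_Ioc (le_min hz.1 hy.1.le)
        (max_le hz.2 hy.2))
  have e : k z = (∫ y in x..x + 1, k y) - ∫ y in x..x + 1, (k y - k z) := by
    rw [intervalIntegral.integral_sub (hk.intervalIntegrable _ _) intervalIntegrable_const]
    simp
  calc ‖k z‖ ≤ ‖∫ y in x..x + 1, k y‖ + ‖∫ y in x..x + 1, (k y - k z)‖ := by
        conv_lhs => rw [e]
        exact norm_sub_le _ _
    _ ≤ _ := by
        rw [hu]
        exact add_le_add (norm_sub_le _ _) hd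

/-- A square integrable function with square integrable second derivative has a square
integrable first derivative, on either half-line. The derivative at `x` is estimated over a window
of length one that points away from the origin. -/
theorem memH2_of_ae_eq_jumpPrim {ψ φ : ℝ → ℂ} (hψ : MemLp ψ 2) (hφ : MemLp φ 2)
    {dp dm cp cm : ℂ} (h : ψ =ᵐ[volume] jumpPrim 0 (jumpPrim 0 φ dp dm) cp cm) :
    MemH2 negHalf ψ ∧ MemH2 posHalf ψ := by
  have lψ : LocallyIntegrable ψ := hψ.locallyIntegrable (by norm_num)
  have lφ : LocallyIntegrable φ := hφ.locallyIntegrable (by norm_num)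
  have lk := locallyIntegrable_jumpPrim lφ 0 dp dm
  have lu := locallyIntegrable_jumpPrim lk 0 cp cm
  have key (Ω : Opens ℝ) (h0 : (0 : ℝ) ∉ Ω)
      (hk : MemLp (jumpPrim 0 φ dp dm) 2 (volume.restrict Ω)) : MemH2 Ω ψ := by
    refine ⟨hψ.restrict _, _, φ, hk, hφ.restrict _, ?_,
      derivD_regDistr_jumpPrim_of_notMem lφ h0 dp dm⟩
    rw [regDistr_congr (lψ.locallyIntegrableOn _) (lu.locallyIntegrableOn _)
      (h.mono fun x hx _ => hx), derivD_regDistr_jumpPrim_of_notMem lk h0]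
  have hN := memLp_window hφ
  have hm (ε : ℝ) := measurePreserving_add_right (volume : Measure ℝ) ε
  have hshift (ε : ℝ) : (fun x => ψ (x + ε)) =ᵐ[volume]
      fun x => jumpPrim 0 (jumpPrim 0 φ dp dm) cp cm (x + ε) :=
    (hm ε).quasiMeasurePreserving.ae_eq h
  refine ⟨key _ (lt_irrefl (0 : ℝ)) ?_, key _ (lt_irrefl (0 : ℝ)) ?_⟩
  · refine MemLp.mono' (g := fun x => ‖ψ x‖ + ‖ψ (x + -1)‖ +
      ∫ y in (x + -1)..(x + -1) + 1, ‖φ y‖) ?_ lk.aestronglyMeasurable.restrict ?_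
    · exact ((hψ.norm.add (hψ.comp_measurePreserving (hm (-1))).norm).add
        (hN.comp_measurePreserving (hm (-1)))).restrict _
    · refine (ae_restrict_iff' negHalf.isOpen.measurableSet).2 ?_
      filter_upwards [h, hshift (-1)] with x h1 h2 hx
      have hx : x < 0 := hx
      have := norm_jumpPrim_le lφ dp dm cp cm (x := x + -1) (z := x) ⟨by linarith, by linarith⟩
        (Or.inr (by linarith))
      rw [h1, h2]
      simpa using this
  · refine MemLp.mono' (g := fun x => ‖ψ (x + 1)‖ + ‖ψ x‖ +
      ∫ y in x..x + 1, ‖φ y‖) ?_ lk.aestronglyMeasurable.restrict ?_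
    · exact (((hψ.comp_measurePreserving (hm 1)).norm.add hψ.norm).add hN).restrict _
    · refine (ae_restrict_iff' posHalf.isOpen.measurableSet).2 ?_
      filter_upwards [h, hshift 1] with x h1 h2 hx
      have := norm_jumpPrim_le lφ dp dm cp cm (x := x) (z := x) ⟨le_rfl, by linarith⟩ (Or.inl hx)
      rwa [h1, h2]

/-! ### The operator `Z` is a restriction of the adjoint of `S` -/

/-- The real part of a test function on `ℝ \ {0}`, as a test function on the line. -/
def reTest (t : 𝓓(punctured, ℂ)) : 𝓓((⊤ : Opens ℝ), ℝ) :=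
  ⟨fun x => (t x).re, Complex.reCLM.contDiff.comp t.contDiff,
    t.hasCompactSupport.comp_left Complex.zero_re, fun _ _ => trivial⟩

/-- The imaginary part of a test function on `ℝ \ {0}`, as a test function on the line. -/
def imTest (t : 𝓓(punctured, ℂ)) : 𝓓((⊤ : Opens ℝ), ℝ) :=
  ⟨fun x => (t x).im, Complex.imCLM.contDiff.comp t.contDiff,
    t.hasCompactSupport.comp_left Complex.zero_im, fun _ _ => trivial⟩

theorem zero_notMem_tsupport_reTest (t : 𝓓(punctured, ℂ)) : (0 : ℝ) ∉ tsupport (reTest t) :=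
  fun h => t.tsupport_subset (tsupport_comp_subset Complex.zero_re t h) rfl

theorem zero_notMem_tsupport_imTest (t : 𝓓(punctured, ℂ)) : (0 : ℝ) ∉ tsupport (imTest t) :=
  fun h => t.tsupport_subset (tsupport_comp_subset Complex.zero_im t h) rfl

theorem differentiable_testFunction (t : 𝓓(punctured, ℂ)) : Differentiable ℝ t :=
  (t.contDiff.of_le (n := ∞) (m := 1) (by exact_mod_cast le_top)).differentiable one_ne_zero

theorem reTest_testDeriv (t : 𝓓(punctured, ℂ)) : reTest (testDeriv t) = ∂_{(1 : ℝ)} (reTest t) := by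
  ext x
  rw [lineDeriv_testFunction_apply]
  change (testDeriv t x).re = _
  rw [testDeriv_apply]
  exact (Complex.reCLM.hasFDerivAt.comp_hasDerivAt x
    (differentiable_testFunction t x).hasDerivAt).deriv.symm

theorem imTest_testDeriv (t : 𝓓(punctured, ℂ)) : imTest (testDeriv t) = ∂_{(1 : ℝ)} (imTest t) := by
  ext x
  rw [lineDeriv_testFunction_apply]
  change (testDeriv t x).im = _
  rw [testDeriv_apply]
  exact (Complex.imCLM.hasFDerivAt.comp_hasDerivAt x
    (differentiable_testFunction t x).hasDerivAt).deriv.symm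

/-- The inner product of `L²` through the pairing of distributions with real test functions. -/
theorem inner_testToL2 (t : 𝓓(punctured, ℂ)) (ψ : L2) :
    inner ℂ (testToL2 t) ψ = ofL2 ψ (reTest t) - Complex.I * ofL2 ψ (imTest t) := by
  have i1 : Integrable fun x => (reTest t x : ℂ) * ψ x :=
    integrable_testFunction_mul (L2.locallyIntegrableOn ψ _) _
  have i2 : Integrable fun x => (imTest t x : ℂ) * ψ x :=
    integrable_testFunction_mul (L2.locallyIntegrableOn ψ _) _
  rw [ofL2_apply, ofL2_apply, ← integral_const_mul, ← integral_sub i1 (i2.const_mul _),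
    L2.inner_def]
  refine integral_congr_ae ?_
  filter_upwards [(testFunction_memLp t).coeFn_toLp] with x hx
  have hx' : testToL2 t x = t x := hx
  rw [hx', RCLike.inner_apply]
  have : (starRingEnd ℂ) (t x) = ((t x).re : ℂ) - Complex.I * (t x).im := by
    apply Complex.ext <;> simp
  rw [this]
  change _ = ((t x).re : ℂ) * ψ x - Complex.I * (((t x).im : ℂ) * ψ x)
  ring

theorem dense_minimalOp_domain : Dense (minimalOp.domain : Set L2) := by
  change Dense ((LinearMap.range testToL2 : Submodule ℂ L2) : Set L2)
  rw [Submodule.dense_iff_topologicalClosure_eq_top, Submodule.topologicalClosure_eq_top_iff,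
    Submodule.eq_bot_iff]
  intro ψ hψ
  have h0 : ∀ᵐ x, x ∈ (punctured : Set ℝ) → ψ x = 0 := by
    refine punctured.isOpen.ae_eq_zero_of_integral_contDiff_smul_eq_zero
      (L2.locallyIntegrableOn ψ _) fun g hg hc hs => ?_
    let t : 𝓓(punctured, ℂ) := ⟨fun x => (g x : ℂ), contDiff_ofReal (by exact_mod_cast hg),
      hc.comp_left Complex.ofReal_zero, (tsupport_comp_subset Complex.ofReal_zero g).trans hs⟩
    have h := (Submodule.mem_orthogonal _ _).1 hψ _ ⟨t, rfl⟩
    have him : imTest t = 0 := by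
      ext x
      exact Complex.ofReal_im (g x)
    rw [inner_testToL2, him, map_zero, mul_zero, sub_zero, ofL2_apply] at h
    simp only [Complex.real_smul]
    exact h
  rw [Lp.eq_zero_iff_ae_eq_zero]
  filter_upwards [h0, compl_mem_ae_iff.2 (measure_singleton (0 : ℝ))] with x hx hx0 using hx hx0

theorem IsBoundaryOp.apply_eq_zero {B : Distr ⊤ →ₗ.[ℂ] Distr ⊤} (hB : IsBoundaryOp B)
    (ψ : B.domain) {t : 𝓓((⊤ : Opens ℝ), ℝ)} (ht : (0 : ℝ) ∉ tsupport t) : B ψ t = 0 :=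
  apply_eq_zero_of_disjoint_dsupport _ t
    (Set.disjoint_left.2 fun _ hx h => ht (Set.mem_singleton_iff.1 (hB ψ h) ▸ hx))

theorem schrodinger_apply_test {B : Distr ⊤ →ₗ.[ℂ] Distr ⊤} (hB : IsBoundaryOp B)
    (ψ : maxDomain B) {t : 𝓓((⊤ : Opens ℝ), ℝ)} (ht : (0 : ℝ) ∉ tsupport t) :
    ofL2 (schrodinger B ψ) t = -ofL2 ψ (∂_{(1 : ℝ)} (∂_{(1 : ℝ)} t : 𝓓((⊤ : Opens ℝ), ℝ))) := by
  rw [ofL2_schrodinger]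
  change -(derivD ⊤ (derivD ⊤ (ofL2 ψ))) t + B ⟨ofL2 ψ, maxDomain_sub ψ⟩ t = _
  rw [hB.apply_eq_zero _ ht, derivD_apply, derivD_apply]
  ring

theorem schrodinger_le_adjoint {B : Distr ⊤ →ₗ.[ℂ] Distr ⊤} (hB : IsBoundaryOp B) :
    schrodinger B ≤ minimalOp.adjoint := by
  refine LinearPMap.IsFormalAdjoint.le_adjoint dense_minimalOp_domain ?_
  rintro ⟨_, t, rfl⟩ ψ
  rw [minimalOp_apply, map_neg, inner_neg_left, inner_testToL2, reTest_testDeriv, imTest_testDeriv,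
    reTest_testDeriv, imTest_testDeriv]
  change _ = inner ℂ (testToL2 t) (schrodinger B ψ)
  rw [inner_testToL2, schrodinger_apply_test hB ψ (zero_notMem_tsupport_reTest t),
    schrodinger_apply_test hB ψ (zero_notMem_tsupport_imTest t)]
  ring

/-! ### The boundary condition -/

theorem diracMul_zero (c : ℕ → ℂ) : diracMul 0 0 c = c 0 • dirac := by
  simp [diracMul, diracAt_zero]

theorem diracMul_one (c : ℕ → ℂ) :
    diracMul 1 0 c = c 0 • derivD ⊤ dirac - c 1 • dirac := by
  simp only [diracMul, Finset.sum_range_succ, Finset.range_zero, Finset.sum_empty, zero_add,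
    diracAt_zero, pow_zero, pow_one, Nat.choose_zero_right, Nat.choose_one_right, Nat.cast_one,
    Nat.sub_zero, Nat.sub_self, Module.End.one_apply, mul_one, one_mul]
  module

section

variable {ψ : L2} {φ : ℝ → ℂ} {dp dm cp cm : ℂ}

theorem ofL2_eq_singular (hφ : LocallyIntegrable φ)
    (h : ψ =ᵐ[volume] jumpPrim 0 (jumpPrim 0 φ dp dm) cp cm) :
    ofL2 ψ = singular 1 (jumpPrim 0 (jumpPrim 0 φ dp dm) cp cm) 0 0 := by
  have lu := locallyIntegrable_jumpPrim (locallyIntegrable_jumpPrim hφ 0 dp dm) 0 cp cm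
  change regDistr ⊤ ψ = _
  rw [regDistr_congr (L2.locallyIntegrableOn ψ _) (lu.locallyIntegrableOn _)
    (h.mono fun x hx _ => hx)]
  ext t
  change regDistr ⊤ _ t = regDistr ⊤ _ t + 0 * _
  rw [zero_mul, add_zero]

theorem derivD_ofL2 (hφ : LocallyIntegrable φ)
    (h : ψ =ᵐ[volume] jumpPrim 0 (jumpPrim 0 φ dp dm) cp cm) :
    derivD ⊤ (ofL2 ψ) = singular 0 (jumpPrim 0 φ dp dm) (cp - cm) 0 := by
  have lk := locallyIntegrable_jumpPrim hφ 0 dp dm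
  change derivD ⊤ (regDistr ⊤ ψ) = _
  rw [regDistr_congr (L2.locallyIntegrableOn ψ _)
    ((locallyIntegrable_jumpPrim lk 0 cp cm).locallyIntegrableOn _) (h.mono fun x hx _ => hx),
    derivD_regDistr_jumpPrim lk]
  rfl

/-- The second derivative of `ψ` is the regular part plus the jump of `ψ'` times `δ` plus the
jump of `ψ` times `δ'`. -/
theorem derivD_derivD_ofL2 (hφ : LocallyIntegrable φ)
    (h : ψ =ᵐ[volume] jumpPrim 0 (jumpPrim 0 φ dp dm) cp cm) :
    derivD ⊤ (derivD ⊤ (ofL2 ψ)) =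
      regDistr ⊤ φ + ((dp - dm) • dirac + (cp - cm) • derivD ⊤ dirac) := by
  rw [derivD_ofL2 hφ h, singular, map_add, map_smul, derivD_regDistr_jumpPrim hφ, diracAt_zero,
    pow_zero, Module.End.one_apply, add_assoc]

/-- The condition `F ψ = 0` says that `B ψ` cancels the singular part of `D_x² ψ`. -/
theorem ofL2_mem_kerF_iff (hφ : LocallyIntegrable φ)
    (h : ψ =ᵐ[volume] jumpPrim 0 (jumpPrim 0 φ dp dm) cp cm) (B : Distr ⊤ →ₗ.[ℂ] Distr ⊤) :
    ofL2 ψ ∈ kerF B ↔ ∃ hd : ofL2 ψ ∈ B.domain,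
      B ⟨ofL2 ψ, hd⟩ = (dp - dm) • dirac + (cp - cm) • derivD ⊤ dirac := by
  have hk := regularOff_jumpPrim_zero hφ 0 dp dm
  have hu := hk.jumpPrim cp cm
  have hV (V : Distr ⊤) : IsBeta 0 (derivD ⊤ (ofL2 ψ)) V ↔ V = (dp - dm) • dirac := by
    rw [derivD_ofL2 hφ h, hk.isBeta_iff, diracMul_zero, diracMul_zero]
    have e : dp • dirac - dm • dirac = (dp - dm) • dirac := by module
    rw [← e]
  have hW (W : Distr ⊤) : IsBeta 1 (ofL2 ψ) W ↔
      W = (cp - cm) • derivD ⊤ dirac - (dp - dm) • dirac := by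
    rw [ofL2_eq_singular hφ h, hu.isBeta_iff, diracMul_one, diracMul_one]
    have e : (cp • derivD ⊤ dirac - dp • dirac) - (cm • derivD ⊤ dirac - dm • dirac) =
        (cp - cm) • derivD ⊤ dirac - (dp - dm) • dirac := by module
    rw [← e]
    exact Iff.rfl
  simp only [kerF, Set.mem_ofPred_eq, IsF, hV, hW]
  refine exists_congr fun hd => ?_
  simp only [↓existsAndEq, true_and]
  have e : -(2 : ℂ) • ((dp - dm) • dirac) - ((cp - cm) • derivD ⊤ dirac - (dp - dm) • dirac) +
      B ⟨ofL2 ψ, hd⟩ = B ⟨ofL2 ψ, hd⟩ - ((dp - dm) • dirac + (cp - cm) • derivD ⊤ dirac) := by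
    module
  rw [e, eq_comm, sub_eq_zero]

end

theorem derivD_derivD_regDistr_apply {Ω : Opens ℝ} {f : ℝ → ℂ} (hf : LocallyIntegrableOn f Ω)
    (t : 𝓓(Ω, ℝ)) : derivD Ω (derivD Ω (regDistr Ω f)) t =
      ∫ x, ((deriv (deriv t) x : ℝ) : ℂ) * f x := by
  rw [derivD_apply, derivD_regDistr_apply hf, neg_neg, coe_lineDeriv_testFunction]

/-- On an open set that misses the origin, `Z ψ = χ` says that `ψ'' = -χ`. -/
theorem derivD_derivD_regDistr_of_mem {B : Distr ⊤ →ₗ.[ℂ] Distr ⊤} (hB : IsBoundaryOp B)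
    {ψ χ : L2} (hd : ofL2 ψ ∈ B.domain)
    (e : -derivD ⊤ (derivD ⊤ (ofL2 ψ)) + B ⟨ofL2 ψ, hd⟩ = ofL2 χ) {Ω : Opens ℝ}
    (h0 : (0 : ℝ) ∉ Ω) :
    derivD Ω (derivD Ω (regDistr Ω ψ)) = regDistr Ω (fun x => -χ x) := by
  have hn : LocallyIntegrableOn (fun x => -χ x) Ω := (L2.locallyIntegrableOn χ _).neg
  ext t
  let t' : 𝓓((⊤ : Opens ℝ), ℝ) := ⟨t, t.contDiff, t.hasCompactSupport, fun _ _ => trivial⟩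
  have h1 := congrArg (fun T : Distr ⊤ => T t') e
  change -(derivD ⊤ (derivD ⊤ (regDistr ⊤ ψ))) t' + B ⟨ofL2 ψ, hd⟩ t' = ofL2 χ t' at h1
  rw [hB.apply_eq_zero _ fun h => h0 (t.tsupport_subset h), add_zero, ofL2_apply,
    derivD_derivD_regDistr_apply (L2.locallyIntegrableOn _ _)] at h1
  rw [derivD_derivD_regDistr_apply (L2.locallyIntegrableOn _ _),
    regDistr_apply hn]
  simp only [mul_neg, integral_neg]
  rw [neg_eq_iff_eq_neg] at h1
  exact h1

theorem ofL2_toLp {f : ℝ → ℂ} (hf : MemLp f 2) : ofL2 (hf.toLp f) = regDistr ⊤ f :=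
  regDistr_congr (L2.locallyIntegrableOn _ _)
    ((hf.locallyIntegrable (by norm_num)).locallyIntegrableOn _)
    (hf.coeFn_toLp.mono fun _ hx _ => hx)

theorem exists_of_mem_H2Sum {ψ : L2} (h : ψ ∈ H2Sum) : ∃ φ : ℝ → ℂ, MemLp φ 2 ∧
    derivD negHalf (derivD negHalf (regDistr negHalf ψ)) = regDistr negHalf φ ∧
    derivD posHalf (derivD posHalf (regDistr posHalf ψ)) = regDistr posHalf φ := by
  obtain ⟨⟨-, f₁, f₂, -, hf, hf₁, hf₂⟩, -, g₁, g₂, -, hg, hg₁, hg₂⟩ := h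
  have hm : MemLp ((Set.Iio (0 : ℝ)).indicator f₂ + (Set.Ioi (0 : ℝ)).indicator g₂) 2 :=
    ((memLp_indicator_iff_restrict measurableSet_Iio).2 hf).add
      ((memLp_indicator_iff_restrict measurableSet_Ioi).2 hg)
  have hl := hm.locallyIntegrable (by norm_num)
  refine ⟨_, hm, ?_, ?_⟩
  · rw [hf₁, hf₂]
    refine regDistr_congr (locallyIntegrableOn_of_locallyIntegrable_restrict
      (hf.locallyIntegrable (by norm_num))) (hl.locallyIntegrableOn _)
      (Eventually.of_forall fun x hx => ?_)
    have hx : x < 0 := hx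
    simp [hx, hx.le]
  · rw [hg₁, hg₂]
    refine regDistr_congr (locallyIntegrableOn_of_locallyIntegrable_restrict
      (hg.locallyIntegrable (by norm_num))) (hl.locallyIntegrableOn _)
      (Eventually.of_forall fun x hx => ?_)
    have hx : 0 < x := hx
    simp [hx, hx.le]

theorem maxDomain_eq {B : Distr ⊤ →ₗ.[ℂ] Distr ⊤} (hB : IsBoundaryOp B) :
    (maxDomain B : Set L2) = (ofL2 ⁻¹' kerF B) ∩ H2Sum := by
  ext ψ
  have hψ : MemLp ψ 2 := Lp.memLp ψ
  have lψ : LocallyIntegrable ψ := hψ.locallyIntegrable (by norm_num)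
  constructor
  · rintro ⟨hd, χ, e⟩
    have hφ : MemLp (fun x => -χ x) 2 := (Lp.memLp χ).neg
    have lφ := hφ.locallyIntegrable (by norm_num)
    obtain ⟨dp, dm, cp, cm, h⟩ := exists_ae_eq_jumpPrim lψ lφ
      (derivD_derivD_regDistr_of_mem hB hd e (lt_irrefl (0 : ℝ)))
      (derivD_derivD_regDistr_of_mem hB hd e (lt_irrefl (0 : ℝ)))
    refine ⟨(ofL2_mem_kerF_iff lφ h B).2 ⟨hd, ?_⟩, memH2_of_ae_eq_jumpPrim hψ hφ h⟩
    have eχ : regDistr ⊤ (fun x => -χ x) = -ofL2 χ := by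
      ext t
      rw [regDistr_apply (lφ.locallyIntegrableOn _)]
      change _ = -ofL2 χ t
      rw [ofL2_apply, ← integral_neg]
      simp only [mul_neg]
    rw [derivD_derivD_ofL2 lφ h, eχ] at e
    rw [← sub_eq_zero] at e ⊢
    rw [← e]
    abel
  · rintro ⟨hk, hH⟩
    obtain ⟨φ, hφ, hn, hp⟩ := exists_of_mem_H2Sum hH
    have lφ := hφ.locallyIntegrable (by norm_num)
    obtain ⟨dp, dm, cp, cm, h⟩ := exists_ae_eq_jumpPrim lψ lφ hn hp
    obtain ⟨hd, e⟩ := (ofL2_mem_kerF_iff lφ h B).1 hk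
    refine ⟨hd, -hφ.toLp φ, ?_⟩
    rw [e, derivD_derivD_ofL2 lφ h, map_neg, ofL2_toLp]
    abel

end PointInteraction

end

theorem theorem4p3
    (B : PointInteraction.Distr ⊤ →ₗ.[ℂ] PointInteraction.Distr ⊤)
    (hB : PointInteraction.IsBoundaryOp B) :
    PointInteraction.schrodinger B ≤ PointInteraction.minimalOp.adjoint ∧
      ((PointInteraction.schrodinger B).domain : Set PointInteraction.L2) =
        (PointInteraction.ofL2 ⁻¹' PointInteraction.kerF B) ∩ PointInteraction.H2Sum :=
  ⟨PointInteraction.schrodinger_le_adjoint hB, PointInteraction.maxDomain_eq hB⟩
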